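/- Fix the reference basis $\{|i\rangle\}$ of a $d$-dimensional Hilbert space, $d\ge 1$, let $\Delta$ be the map that deletes the off-diagonal entries of a matrix in this basis, let $\|\cdot\|_\infty$ be the operator norm (largest singular value), and let $\log=\log_2$. A density matrix $\omega$ is incoherent if $\Delta(\omega)=\omega$. Let $\mathcal O$ be any one of the following four classes of quantum channels (completely positive trace-preserving maps), where a matrix $K$ is called incoherent if $K\omega K^\dagger/\mathrm{Tr}(K\omega K^\dagger)$ is an incoherent state for every incoherent state $\omega$ with $\mathrm{Tr}(K\omega K^\dagger)\neq 0$: MIO (channels that map incoherent states to incoherent states), DIO (channels that commute with $\Delta$), IO (channels with a Kraus decomposition $\{K_\ell\}$ into incoherent matrices), SIO (channels with a Kraus decomposition in which all $K_\ell$ and all $K_\ell^\dagger$ are incoherent). For a state $\rho$ and $m\ge 1$ put $|\Psi_m\rangle=\frac1{\sqrt m}\sum_{i=1}^m|i\rangle$ and $$F_{A,\mathcal O}(\rho,m)=\sup\Big\{\Big\langle \sum_i p_i\Lambda_i(|\psi_i\rangle\langle\psi_i|),\,|\Psi_m\rangle\langle\Psi_m|\Big\rangle \;:\; \rho=\sum_i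 p_i|\psi_i\rangle\langle\psi_i|,\ \Lambda_i\in\mathcal O\Big\},$$ where $\langle X,Y\rangle=\mathrm{Tr}(X^\dagger Y)$, the decompositions are finite pure-state decompositions (the $p_i$ are probabilities and the $\psi_i$ are unit vectors), and the $\Lambda_i$ have $m$-dimensional output. The zero-error one-shot assisted distillable coherence is $C^{(1),0}_{A,\mathcal O}(\rho)=\log\max\{m\ge 1: F_{A,\mathcal O}(\rho,m)\ge 1\}$, and the asymptotic zero-error rate is $\lim_{n\to\infty}\frac1n C^{(1),0}_{A,\mathcal O}(\rho^{\otimes n})$. For every state $\rho$ in any finite dimension $d$, the maximum and the limit exist, and $$C^{(1),0}_{A,\mathcal O}(\rho)\le\log\big\lfloor\|\Delta(\rho)\|_\infty^{-1}\big\rfloor,\qquad \lim_{n\to\infty}\tfrac1n C^{(1),0}_{A,\mathcal O}(\rho^{\otimes n})\le-\log\|\Delta(\rho)\|_\infty .$$ If $d\le 3$, or if $d$ is arbitrary and $\rho$ is pure, then both inequalities are equalities, and for $m=\lfloor\|\Delta(\rho)\|_\infty^{-1}\rfloor$ some decomposition and some operations in $\mathcal O$ reach fidelity exactly $1$. -/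

import Mathlib

open Filter Topology
open scoped ComplexOrder

namespace AssistedCoherence

/-- Density matrices (states) in the fixed reference basis indexed by `ι`. -/
structure IsDensityMatrix {ι : Type*} [Fintype ι] (ρ : Matrix ι ι ℂ) : Prop where
  posSemidef : ρ.PosSemidef
  trace_eq_one : ρ.trace = 1

/-- The dephasing map `Δ`, which keeps the diagonal and deletes all other entries. -/
def dephase {ι : Type*} [DecidableEq ι] (X : Matrix ι ι ℂ) : Matrix ι ι ℂ :=
  Matrix.diagonal fun i => X i i

/-- Incoherent states: density matrices that are fixed by `Δ`. -/
structure IsIncoherent {ι : Type*} [Fintype ι] [DecidableEq ι] (ω : Matrix ι ι ℂ) : Prop where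
  isDensityMatrix : IsDensityMatrix ω
  eq_dephase : ω = dephase ω

/-- The Schatten `∞`-norm (largest singular value): the operator norm of the matrix acting on
the Euclidean (Hilbert) space. -/
noncomputable def opNorm {ι : Type*} [Fintype ι] [DecidableEq ι] (X : Matrix ι ι ℂ) : ℝ :=
  ‖Matrix.toEuclideanCLM (n := ι) (𝕜 := ℂ) X‖

/-- `ψ` is a normalized vector. -/
def IsUnitVector {ι : Type*} [Fintype ι] (ψ : ι → ℂ) : Prop :=
  ∑ i, ‖ψ i‖ ^ 2 = 1

/-- The rank-one operator `|ψ⟩⟨ψ|`. -/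
def ketbra {ι : Type*} (ψ : ι → ℂ) : Matrix ι ι ℂ :=
  Matrix.vecMulVec ψ (star ψ)

/-- The Hilbert-Schmidt inner product `⟨X, Y⟩ = Tr (X† Y)`. -/
def hsInner {ι : Type*} [Fintype ι] (X Y : Matrix ι ι ℂ) : ℂ :=
  (X.conjTranspose * Y).trace

/-- The `m`-dimensional maximally coherent vector `∑ i, |i⟩ / √m`. -/
noncomputable def maxCoherent (m : ℕ) : Fin m → ℂ :=
  fun _ => ((1 / Real.sqrt m : ℝ) : ℂ)

/-- The `n`-fold tensor power `ρ^{⊗ n}`, written in the product basis indexed by `Fin n → ι`. -/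
def tensorPow {ι : Type*} (ρ : Matrix ι ι ℂ) (n : ℕ) : Matrix (Fin n → ι) (Fin n → ι) ℂ :=
  Matrix.of fun a b => ∏ k, ρ (a k) (b k)

/-- The map `Λ ⊗ id_k`: `Λ` acts on each of the `k × k` blocks labelled by the second factor. -/
def ampliation {ι κ : Type*} (Λ : Matrix ι ι ℂ →ₗ[ℂ] Matrix κ κ ℂ) (k : ℕ)
    (X : Matrix (ι × Fin k) (ι × Fin k) ℂ) : Matrix (κ × Fin k) (κ × Fin k) ℂ :=
  Matrix.of fun a b => Λ (Matrix.of fun i j => X (i, a.2) (j, b.2)) a.1 b.1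

/-- Quantum channels: completely positive trace-preserving linear maps. -/
structure IsChannel {ι κ : Type*} [Fintype ι] [Fintype κ]
    (Λ : Matrix ι ι ℂ →ₗ[ℂ] Matrix κ κ ℂ) : Prop where
  completelyPositive : ∀ (k : ℕ) (X : Matrix (ι × Fin k) (ι × Fin k) ℂ),
    X.PosSemidef → (ampliation Λ k X).PosSemidef
  tracePreserving : ∀ X : Matrix ι ι ℂ, (Λ X).trace = X.trace

/-- A Kraus operator is incoherent if every outcome `K ω K† / Tr (K ω K†)` of nonzero probability
on an incoherent state `ω` is an incoherent state. -/
def IsIncoherentKraus {ι κ : Type*} [Fintype ι] [Fintype κ] [DecidableEq ι] [DecidableEq κ]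
    (K : Matrix κ ι ℂ) : Prop :=
  ∀ ω : Matrix ι ι ℂ, IsIncoherent ω → (K * ω * K.conjTranspose).trace ≠ 0 →
    IsIncoherent ((K * ω * K.conjTranspose).trace⁻¹ • (K * ω * K.conjTranspose))

/-- `K` is a (finite) Kraus decomposition of `Λ`. -/
def IsKrausDecomposition {ι κ : Type*} [Fintype ι] {r : ℕ} (K : Fin r → Matrix κ ι ℂ)
    (Λ : Matrix ι ι ℂ →ₗ[ℂ] Matrix κ κ ℂ) : Prop :=
  ∀ X : Matrix ι ι ℂ, Λ X = ∑ l, K l * X * (K l).conjTranspose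

/-- The four classes of free operations. -/
inductive FreeClass where
  | maximallyIncoherent
  | dephasingCovariant
  | incoherent
  | strictlyIncoherent

/-- Membership of a map in a class of free operations. -/
def FreeClass.Contains {ι κ : Type*} [Fintype ι] [Fintype κ] [DecidableEq ι] [DecidableEq κ]
    (O : FreeClass) (Λ : Matrix ι ι ℂ →ₗ[ℂ] Matrix κ κ ℂ) : Prop :=
  match O with
  | .maximallyIncoherent => IsChannel Λ ∧ ∀ ω, IsIncoherent ω → IsIncoherent (Λ ω)
  | .dephasingCovariant => IsChannel Λ ∧ ∀ X, dephase (Λ X) = Λ (dephase X)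
  | .incoherent => IsChannel Λ ∧ ∃ (r : ℕ) (K : Fin r → Matrix κ ι ℂ),
      IsKrausDecomposition K Λ ∧ ∀ l, IsIncoherentKraus (K l)
  | .strictlyIncoherent => IsChannel Λ ∧ ∃ (r : ℕ) (K : Fin r → Matrix κ ι ℂ),
      IsKrausDecomposition K Λ ∧
        ∀ l, IsIncoherentKraus (K l) ∧ IsIncoherentKraus (K l).conjTranspose

/-- `p, ψ` is a pure-state decomposition `ρ = ∑ i, p i |ψ i⟩⟨ψ i|`. -/
structure IsPureDecomposition {ι : Type*} [Fintype ι] {r : ℕ} (ρ : Matrix ι ι ℂ)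
    (p : Fin r → ℝ) (ψ : Fin r → ι → ℂ) : Prop where
  nonneg : ∀ i, 0 ≤ p i
  sum_eq_one : ∑ i, p i = 1
  unit : ∀ i, IsUnitVector (ψ i)
  eq_sum : ρ = ∑ i, (p i : ℂ) • ketbra (ψ i)

/-- The average fidelities `⟨∑ i, p i Λ i (ψ i), Ψ_m⟩` that are reached by some pure-state
decomposition of `ρ` and some free operations `Λ i`. -/
def achievableFidelities {ι : Type*} [Fintype ι] [DecidableEq ι] (O : FreeClass)
    (ρ : Matrix ι ι ℂ) (m : ℕ) : Set ℝ :=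
  {f | ∃ (r : ℕ) (p : Fin r → ℝ) (ψ : Fin r → ι → ℂ)
      (Λ : Fin r → (Matrix ι ι ℂ →ₗ[ℂ] Matrix (Fin m) (Fin m) ℂ)),
      IsPureDecomposition ρ p ψ ∧ (∀ i, O.Contains (Λ i)) ∧
      f = (hsInner (∑ i, (p i : ℂ) • Λ i (ketbra (ψ i))) (ketbra (maxCoherent m))).re}

/-- The fidelity of assisted distillation: the best average fidelity with `Ψ_m`. -/
noncomputable def assistedFidelity {ι : Type*} [Fintype ι] [DecidableEq ι] (O : FreeClass)
    (ρ : Matrix ι ι ℂ) (m : ℕ) : ℝ :=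
  sSup (achievableFidelities O ρ m)

/-- The dimensions `m ≥ 1` for which assisted distillation of `Ψ_m` with error `ε` is possible. -/
def distillableDims {ι : Type*} [Fintype ι] [DecidableEq ι] (O : FreeClass) (ε : ℝ)
    (ρ : Matrix ι ι ℂ) : Set ℕ :=
  {m | 1 ≤ m ∧ 1 - ε ≤ assistedFidelity O ρ m}

/-- The one-shot assisted distillable coherence with error `ε`, in bits:
the logarithm of the largest distillable dimension. -/
noncomputable def assistedDistillableCoherence {ι : Type*} [Fintype ι] [DecidableEq ι]
    (O : FreeClass) (ε : ℝ) (ρ : Matrix ι ι ℂ) : ℝ :=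
  Real.logb 2 (sSup (distillableDims O ε ρ) : ℕ)

end AssistedCoherence

open AssistedCoherence

set_option linter.unusedSectionVars false

/-! Everything reduces to one criterion, `mem_distillableDims_iff`: `Ψ_m` is distillable with zero
error iff `ρ` is a mixture of pure states whose populations are all at most `1 / m`. The operations
no longer appear in it, so the four classes behave alike.

Achievability: if the populations of `ψ` are at most `1 / m`, Birkhoff's theorem realises them as
marginals of a random injective list of `m` basis labels. Kraus operators that read off such a list
and equalise the amplitudes map `ψ` exactly to `Ψ_m`, and they lie in all four classes. Converse:
only preservation of incoherent states is used. A Cauchy-Schwarz estimate gives `|ψ i| ≤ 1/√m + √(1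
- s)` for output fidelity `s`. Since the fidelity is a supremum, one passes to the compact convex
hull of pairs (pure state, fidelity) obeying this bound; average fidelity one then forces `s = 1` on
every term of positive weight.

Populations are affine in the state, so the criterion gives `m ≤ ‖Δ(ρ)‖⁻¹`. Products of
decompositions make the coherence superadditive, and Fekete's lemma gives the limit. Equality needs
a decomposition with populations at most `‖Δ(ρ)‖`: trivial for pure states, while for `d ≤ 3`
Krein-Milman applies because the extreme positive semidefinite matrices with prescribed diagonal
have rank at most one. This bound survives tensor powers, and the floor costs at most one bit in
total. -/

theorem isCompact_convexHull_of_finiteDimensional {E : Type*} [AddCommGroup E] [Module ℝ E]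
    [TopologicalSpace E] [ContinuousAdd E] [ContinuousSMul ℝ E] [FiniteDimensional ℝ E]
    {s : Set E} (hs : IsCompact s) : IsCompact (convexHull ℝ s) := by
  rcases s.eq_empty_or_nonempty with rfl | ⟨x₀, hx₀⟩
  · simp
  -- By Carathéodory, `n` points always suffice, so the hull is a continuous image of the compact
  -- set simplex × `sⁿ`.
  set n := Module.finrank ℝ E + 1 with hn
  have hc : IsCompact ((fun q : (Fin n → ℝ) × (Fin n → E) => ∑ i, q.1 i • q.2 i) ''
      (stdSimplex ℝ (Fin n) ×ˢ Set.univ.pi fun _ => s)) := by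
    refine IsCompact.image ?_ (by fun_prop)
    exact (isCompact_stdSimplex ℝ (Fin n)).prod (isCompact_univ_pi fun _ => hs)
  convert hc using 1
  ext x
  constructor
  · intro hx
    obtain ⟨κ, _, z, w, hz, hind, hw, hw1, rfl⟩ := eq_pos_convex_span_of_mem_convexHull hx
    have hcard : Fintype.card κ ≤ n :=
      hind.card_le_finrank_succ.trans (Nat.succ_le_succ (Submodule.finrank_le _))
    obtain ⟨e⟩ : Nonempty (κ ↪ Fin n) :=
      Function.Embedding.nonempty_of_card_le (by simpa using hcard)
    -- Unused slots get weight zero and the dummy point `x₀`.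
    refine ⟨(Function.extend e w 0, Function.extend e z fun _ => x₀), ⟨⟨?_, ?_⟩, ?_⟩, ?_⟩
    · intro i
      by_cases hi : ∃ k, e k = i
      · obtain ⟨k, rfl⟩ := hi
        simpa [e.injective.extend_apply] using (hw k).le
      · simp [Function.extend_apply' _ _ _ hi]
    · rw [← hw1]
      refine (Fintype.sum_of_injective e e.injective _ _ ?_ ?_).symm
      · intro i hi
        simp [Function.extend_apply' _ _ _ (by simpa using hi)]
      · intro k
        simp [e.injective.extend_apply]
    · intro i _
      by_cases hi : ∃ k, e k = i
      · obtain ⟨k, rfl⟩ := hi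
        simpa [e.injective.extend_apply] using hz ⟨k, rfl⟩
      · simpa [Function.extend_apply' _ _ _ hi] using hx₀
    · refine (Fintype.sum_of_injective e e.injective _ _ ?_ ?_).symm
      · intro i hi
        simp [Function.extend_apply' _ _ _ (by simpa using hi)]
      · intro k
        simp [e.injective.extend_apply]
  · rintro ⟨q, ⟨⟨h0, h1⟩, hq⟩, rfl⟩
    exact mem_convexHull_of_exists_fintype q.1 q.2 h0 h1 (fun i => hq i trivial) rfl


namespace AssistedCoherence

section OpNorm

open scoped Matrix.Norms.L2Operator

theorem opNorm_dephase {ι : Type*} [Fintype ι] [DecidableEq ι] (X : Matrix ι ι ℂ) :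
    opNorm (dephase X) = ‖fun i => X i i‖ := by
  rw [← Matrix.l2_opNorm_diagonal]
  rfl

end OpNorm

/-! ### Mixtures of pure states with bounded populations, and their tensor products -/

variable {ι : Type*} [Fintype ι]

theorem ketbra_apply (ψ : ι → ℂ) (i j : ι) : ketbra ψ i j = ψ i * star (ψ j) := rfl

theorem ketbra_diag (ψ : ι → ℂ) (i : ι) : ketbra ψ i i = ((‖ψ i‖ ^ 2 : ℝ) : ℂ) := by
  simp [ketbra_apply, Complex.mul_conj, Complex.normSq_eq_norm_sq]

theorem trace_ketbra (ψ : ι → ℂ) : (ketbra ψ).trace = ((∑ i, ‖ψ i‖ ^ 2 : ℝ) : ℂ) := by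
  simp [Matrix.trace, ketbra_diag]

theorem posSemidef_ketbra (ψ : ι → ℂ) : (ketbra ψ).PosSemidef :=
  Matrix.posSemidef_vecMulVec_self_star ψ

theorem ketbra_smul (c : ℂ) (ψ : ι → ℂ) :
    ketbra (c • ψ) = ((‖c‖ ^ 2 : ℝ) : ℂ) • ketbra ψ := by
  ext i j
  have h : ((‖c‖ ^ 2 : ℝ) : ℂ) = c * star c := by
    simp [Complex.mul_conj, Complex.normSq_eq_norm_sq]
  rw [Matrix.smul_apply, ketbra_apply, ketbra_apply, h]
  simp
  ring

theorem IsUnitVector.isDensityMatrix {ψ : ι → ℂ} (h : IsUnitVector ψ) :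
    IsDensityMatrix (ketbra ψ) where
  posSemidef := posSemidef_ketbra ψ
  trace_eq_one := by rw [trace_ketbra, h]; simp

theorem isCompact_setOf_isUnitVector : IsCompact {ψ : ι → ℂ | IsUnitVector ψ} := by
  refine (isCompact_closedBall (0 : ι → ℂ) 1).of_isClosed_subset ?_ ?_
  · exact isClosed_eq (by fun_prop) continuous_const
  · intro ψ (h : ∑ i, ‖ψ i‖ ^ 2 = 1)
    rw [mem_closedBall_zero_iff, pi_norm_le_iff_of_nonneg zero_le_one]
    intro i
    have := Finset.single_le_sum (f := fun i => ‖ψ i‖ ^ 2) (fun i _ => by positivity)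
      (Finset.mem_univ i)
    rw [h] at this
    exact (sq_le_one_iff₀ (norm_nonneg _)).1 this

theorem continuous_ketbra : Continuous (ketbra : (ι → ℂ) → Matrix ι ι ℂ) := by
  unfold ketbra
  exact continuous_id.matrix_vecMulVec continuous_star

/-- The pure states all of whose populations in the reference basis are at most `c`. -/
def boundedPureStates (ι : Type*) [Fintype ι] (c : ℝ) : Set (Matrix ι ι ℂ) :=
  {X | ∃ ψ : ι → ℂ, IsUnitVector ψ ∧ (∀ i, ‖ψ i‖ ^ 2 ≤ c) ∧ ketbra ψ = X}

theorem boundedPureStates_mono {c c' : ℝ} (h : c ≤ c') :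
    boundedPureStates ι c ⊆ boundedPureStates ι c' := by
  rintro _ ⟨ψ, hψ, hc, rfl⟩
  exact ⟨ψ, hψ, fun i => (hc i).trans h, rfl⟩

/-- `IsMixtureOfBounded c ρ`: the matrix `ρ` is a mixture of pure states all of whose populations
are at most `c`. -/
def IsMixtureOfBounded (c : ℝ) (ρ : Matrix ι ι ℂ) : Prop :=
  ρ ∈ convexHull ℝ (boundedPureStates ι c)

theorem IsMixtureOfBounded.mono {c c' : ℝ} {ρ : Matrix ι ι ℂ} (hρ : IsMixtureOfBounded c ρ)
    (h : c ≤ c') : IsMixtureOfBounded c' ρ :=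
  convexHull_mono (boundedPureStates_mono h) hρ

/-- The real-linear functional reading off the real part of an entry. -/
def entryRe (i j : ι) : Matrix ι ι ℂ →ₗ[ℝ] ℝ where
  toFun X := (X i j).re
  map_add' := by simp
  map_smul' := by simp

theorem IsMixtureOfBounded.diag_le {c : ℝ} {ρ : Matrix ι ι ℂ} (hρ : IsMixtureOfBounded c ρ)
    (i : ι) : (ρ i i).re ≤ c := by
  refine convexHull_min ?_ ((convex_Iic c).linear_preimage (entryRe i i)) hρ
  rintro _ ⟨ψ, -, hc, rfl⟩
  change (ketbra ψ i i).re ≤ c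
  rw [ketbra_diag, Complex.ofReal_re]
  exact hc i

theorem IsMixtureOfBounded.exists_isPureDecomposition {c : ℝ} {ρ : Matrix ι ι ℂ}
    (hρ : IsMixtureOfBounded c ρ) :
    ∃ (r : ℕ) (p : Fin r → ℝ) (ψ : Fin r → ι → ℂ), IsPureDecomposition ρ p ψ ∧
      ∀ k i, ‖ψ k i‖ ^ 2 ≤ c := by
  obtain ⟨κ, _, w, z, h0, h1, hz, rfl⟩ := mem_convexHull_iff_exists_fintype.1 hρ
  choose ψ hψ hc hz using hz
  let e := (Fintype.equivFin κ).symm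
  refine ⟨Fintype.card κ, w ∘ e, ψ ∘ e, ⟨fun k => h0 _, ?_, fun k => hψ _, ?_⟩, fun k => hc _⟩
  · rw [← h1]
    exact e.sum_comp w
  · rw [← e.sum_comp]
    simp [hz, Complex.coe_smul]

theorem IsUnitVector.sq_norm_le_one {ψ : ι → ℂ} (h : IsUnitVector ψ) (i : ι) :
    ‖ψ i‖ ^ 2 ≤ 1 := by
  rw [← show ∑ i, ‖ψ i‖ ^ 2 = 1 from h]
  exact Finset.single_le_sum (f := fun i => ‖ψ i‖ ^ 2) (fun i _ => by positivity)
    (Finset.mem_univ i)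

theorem exists_eq_sum_ketbra {ρ : Matrix ι ι ℂ} (hρ : ρ.PosSemidef) :
    ∃ (m : ℕ) (b : Fin m → ι → ℂ), ρ = ∑ k, ketbra (b k) :=
  Matrix.posSemidef_iff_eq_sum_vecMulVec.1 hρ

theorem IsDensityMatrix.isMixtureOfBounded_one {ρ : Matrix ι ι ℂ} (hρ : IsDensityMatrix ρ) :
    IsMixtureOfBounded 1 ρ := by
  classical
  obtain ⟨m, b, rfl⟩ := exists_eq_sum_ketbra hρ.posSemidef
  have hsum : ∑ k, ∑ i, ‖b k i‖ ^ 2 = 1 := by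
    have := hρ.trace_eq_one
    rw [Matrix.trace_sum] at this
    simp_rw [trace_ketbra] at this
    exact_mod_cast this
  have hne : Nonempty ι := by
    by_contra h
    rw [not_nonempty_iff] at h
    simp at hsum
  obtain ⟨i₀⟩ := hne
  -- The squared norms become the weights; a zero vector cannot be normalised, so it is replaced by
  -- an arbitrary basis vector of weight zero.
  let φ : Fin m → ι → ℂ := fun k => if ∑ i, ‖b k i‖ ^ 2 = 0 then Pi.single i₀ 1 else
    ((√(∑ i, ‖b k i‖ ^ 2))⁻¹ : ℂ) • b k
  have hφ : ∀ k, IsUnitVector (φ k) := by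
    intro k
    unfold IsUnitVector
    by_cases h : ∑ i, ‖b k i‖ ^ 2 = 0
    · simp only [φ, h, if_true]
      rw [Finset.sum_eq_single i₀] <;> simp +contextual
    · have h' : 0 ≤ ∑ i, ‖b k i‖ ^ 2 := Finset.sum_nonneg fun i _ => by positivity
      simp only [φ, h, if_false, Pi.smul_apply, smul_eq_mul, norm_mul, mul_pow]
      rw [← Finset.mul_sum]
      simp [Real.sq_sqrt h', inv_pow, h]
  refine mem_convexHull_of_exists_fintype (fun k => ∑ i, ‖b k i‖ ^ 2) (fun k => ketbra (φ k))
    (fun k => Finset.sum_nonneg fun i _ => by positivity) hsum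
    (fun k => ⟨φ k, hφ k, fun i => (hφ k).sq_norm_le_one i, rfl⟩) ?_
  refine Finset.sum_congr rfl fun k _ => ?_
  have h' : 0 ≤ ∑ i, ‖b k i‖ ^ 2 := Finset.sum_nonneg fun i _ => by positivity
  by_cases h : ∑ i, ‖b k i‖ ^ 2 = 0
  · rw [h, zero_smul]
    have hb : b k = 0 := by
      funext i
      have := (Finset.sum_eq_zero_iff_of_nonneg (fun i _ => by positivity)).1 h i
        (Finset.mem_univ i)
      simpa using this
    ext i j
    simp [hb, ketbra_apply]
  · simp only [φ, h, if_false]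
    rw [ketbra_smul]
    ext i j
    have h3 : ‖((√(∑ i, ‖b k i‖ ^ 2))⁻¹ : ℂ)‖ ^ 2 = (∑ i, ‖b k i‖ ^ 2)⁻¹ := by
      simp [inv_pow, Real.sq_sqrt h']
    rw [h3, Matrix.smul_apply, Matrix.smul_apply, Complex.real_smul, smul_eq_mul, ← mul_assoc,
      ← Complex.ofReal_mul, mul_inv_cancel₀ h]
    simp

/-- The tensor product of two matrices, indexed through an identification of the product basis. -/
def tensorVia {α β κ : Type*} (e : κ ≃ α × β) (X : Matrix α α ℂ) (Y : Matrix β β ℂ) :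
    Matrix κ κ ℂ :=
  Matrix.of fun a b => X (e a).1 (e b).1 * Y (e a).2 (e b).2

/-- The tensor product is bilinear, so minimality of the hull in each argument reduces the claim to
product vectors, whose populations multiply. -/
theorem IsMixtureOfBounded.tensorVia {α β κ : Type*} [Fintype α] [Fintype β] [Fintype κ]
    (e : κ ≃ α × β) {X : Matrix α α ℂ} {Y : Matrix β β ℂ} {c c' : ℝ}
    (hX : IsMixtureOfBounded c X) (hY : IsMixtureOfBounded c' Y) :
    IsMixtureOfBounded (c * c') (tensorVia e X Y) := by
  let f (Y : Matrix β β ℂ) : Matrix α α ℂ →ₗ[ℝ] Matrix κ κ ℂ :=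
    { toFun := fun X => AssistedCoherence.tensorVia e X Y
      map_add' := fun X X' => by ext; simp [AssistedCoherence.tensorVia, add_mul]
      map_smul' := fun r X => by ext; simp [AssistedCoherence.tensorVia, mul_assoc] }
  let g (X : Matrix α α ℂ) : Matrix β β ℂ →ₗ[ℝ] Matrix κ κ ℂ :=
    { toFun := fun Y => AssistedCoherence.tensorVia e X Y
      map_add' := fun X X' => by ext; simp [AssistedCoherence.tensorVia, mul_add]
      map_smul' := fun r X => by ext; simp [AssistedCoherence.tensorVia, mul_left_comm] }
  refine convexHull_min (t := f Y ⁻¹' _) ?_ ((convex_convexHull ℝ _).linear_preimage (f Y)) hX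
  intro X hX
  refine convexHull_min (t := g X ⁻¹' _) ?_ ((convex_convexHull ℝ _).linear_preimage (g X)) hY
  rintro _ ⟨φ, hφ, hφc, rfl⟩
  obtain ⟨ψ, hψ, hψc, rfl⟩ := hX
  refine subset_convexHull ℝ _ ⟨fun a => ψ (e a).1 * φ (e a).2, ?_, ?_, ?_⟩
  · unfold IsUnitVector at *
    rw [e.sum_comp (fun q : α × β => ‖ψ q.1 * φ q.2‖ ^ 2)]
    simp_rw [norm_mul, mul_pow, Fintype.sum_prod_type, ← Finset.mul_sum, hφ, mul_one, hψ]
  · intro a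
    rw [norm_mul, mul_pow]
    exact mul_le_mul (hψc _) (hφc _) (by positivity)
      ((by positivity : (0 : ℝ) ≤ _).trans (hψc (e a).1))
  · ext a b
    change _ = ketbra ψ _ _ * ketbra φ _ _
    simp [ketbra_apply]
    ring

theorem IsMixtureOfBounded.tensorPow_add {ρ : Matrix ι ι ℂ} {m n : ℕ} {c c' : ℝ}
    (h : IsMixtureOfBounded c (tensorPow ρ m)) (h' : IsMixtureOfBounded c' (tensorPow ρ n)) :
    IsMixtureOfBounded (c * c') (tensorPow ρ (m + n)) := by
  convert IsMixtureOfBounded.tensorVia (Fin.appendEquiv m n).symm h h' using 1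
  ext a b
  simp [tensorPow, AssistedCoherence.tensorVia, Fin.prod_univ_add, Fin.appendEquiv]

theorem IsMixtureOfBounded.tensorPow {ρ : Matrix ι ι ℂ} {c : ℝ} (h : IsMixtureOfBounded c ρ)
    (n : ℕ) : IsMixtureOfBounded (c ^ n) (tensorPow ρ n) := by
  induction n with
  | zero =>
    refine subset_convexHull ℝ _ ⟨fun _ => 1, by simp [IsUnitVector], by simp, ?_⟩
    ext a b
    simp [AssistedCoherence.tensorPow, ketbra_apply]
  | succ n ih =>
    rw [pow_succ']
    convert IsMixtureOfBounded.tensorVia (Fin.consEquiv fun _ => ι).symm h ih using 1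
    ext a b
    simp [AssistedCoherence.tensorPow, AssistedCoherence.tensorVia, Fin.prod_univ_succ,
      Fin.consEquiv, Fin.tail]

/-! ### What the four classes have in common -/

section Classes

variable {ι κ : Type*} [Fintype ι] [Fintype κ]

theorem IsChannel.posSemidef_apply {Λ : Matrix ι ι ℂ →ₗ[ℂ] Matrix κ κ ℂ} (h : IsChannel Λ)
    {X : Matrix ι ι ℂ} (hX : X.PosSemidef) : (Λ X).PosSemidef :=
  (h.completelyPositive 1 (X.submatrix Prod.fst Prod.fst) (hX.submatrix _)).submatrix
    fun i => (i, (0 : Fin 1))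

theorem IsChannel.isDensityMatrix_apply {Λ : Matrix ι ι ℂ →ₗ[ℂ] Matrix κ κ ℂ} (h : IsChannel Λ)
    {X : Matrix ι ι ℂ} (hX : IsDensityMatrix X) : IsDensityMatrix (Λ X) where
  posSemidef := h.posSemidef_apply hX.posSemidef
  trace_eq_one := by rw [h.tracePreserving, hX.trace_eq_one]

variable [DecidableEq ι] [DecidableEq κ]

theorem eq_dephase_iff {X : Matrix ι ι ℂ} : X = dephase X ↔ ∀ i j, i ≠ j → X i j = 0 := by
  constructor
  · intro h i j hij
    rw [h, dephase, Matrix.diagonal_apply_ne _ hij]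
  · intro h
    ext i j
    by_cases hij : i = j
    · subst hij
      simp [dephase]
    · simp [dephase, Matrix.diagonal_apply_ne _ hij, h i j hij]

theorem IsIncoherentKraus.of_diagonal {K : Matrix κ ι ℂ}
    (h : ∀ ω : Matrix ι ι ℂ, (∀ i j, i ≠ j → ω i j = 0) →
      ∀ i j, i ≠ j → (K * ω * K.conjTranspose) i j = 0) : IsIncoherentKraus K := by
  intro ω hω htr
  have hpos : (K * ω * K.conjTranspose).PosSemidef :=
    hω.isDensityMatrix.posSemidef.mul_mul_conjTranspose_same K
  refine ⟨⟨hpos.smul (inv_nonneg.2 hpos.trace_nonneg), ?_⟩, eq_dephase_iff.2 fun i j hij => ?_⟩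
  · rw [Matrix.trace_smul, smul_eq_mul, inv_mul_cancel₀ htr]
  · rw [Matrix.smul_apply, h ω (eq_dephase_iff.1 hω.eq_dephase) i j hij, smul_zero]

/-- The proviso of nonzero probability loses nothing: a positive semidefinite outcome of trace zero
vanishes. -/
theorem IsIncoherentKraus.apply_eq_zero {K : Matrix κ ι ℂ} (h : IsIncoherentKraus K)
    {ω : Matrix ι ι ℂ} (hω : IsIncoherent ω) {i j : κ} (hij : i ≠ j) :
    (K * ω * K.conjTranspose) i j = 0 := by
  by_cases htr : (K * ω * K.conjTranspose).trace = 0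
  · have hpos : (K * ω * K.conjTranspose).PosSemidef :=
      hω.isDensityMatrix.posSemidef.mul_mul_conjTranspose_same K
    rw [hpos.trace_eq_zero_iff.1 htr, Matrix.zero_apply]
  · have := eq_dephase_iff.1 (h ω hω htr).eq_dephase i j hij
    rw [Matrix.smul_apply, smul_eq_mul] at this
    exact (mul_eq_zero.1 this).resolve_left (inv_ne_zero htr)

theorem FreeClass.Contains.isChannel {O : FreeClass} {Λ : Matrix ι ι ℂ →ₗ[ℂ] Matrix κ κ ℂ}
    (h : O.Contains Λ) : IsChannel Λ := by
  cases O <;> exact h.1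

/-- Every class lies inside MIO; beyond being a channel, this is all that the converse uses of `O`.
-/
theorem FreeClass.Contains.isIncoherent_apply {O : FreeClass}
    {Λ : Matrix ι ι ℂ →ₗ[ℂ] Matrix κ κ ℂ} (h : O.Contains Λ) {ω : Matrix ι ι ℂ}
    (hω : IsIncoherent ω) : IsIncoherent (Λ ω) := by
  have key : (∃ (r : ℕ) (K : Fin r → Matrix κ ι ℂ),
      IsKrausDecomposition K Λ ∧ ∀ l, IsIncoherentKraus (K l)) → IsIncoherent (Λ ω) := by
    rintro ⟨r, K, hK, hinc⟩
    refine ⟨h.isChannel.isDensityMatrix_apply hω.isDensityMatrix,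
      eq_dephase_iff.2 fun i j hij => ?_⟩
    rw [hK, Matrix.sum_apply]
    exact Finset.sum_eq_zero fun l _ => (hinc l).apply_eq_zero hω hij
  cases O with
  | maximallyIncoherent => exact h.2 ω hω
  | dephasingCovariant =>
    refine ⟨h.isChannel.isDensityMatrix_apply hω.isDensityMatrix, ?_⟩
    rw [h.2, ← hω.eq_dephase]
  | incoherent => exact key h.2
  | strictlyIncoherent =>
    obtain ⟨r, K, hK, hinc⟩ := h.2
    exact key ⟨r, K, hK, fun l => (hinc l).1⟩

end Classes

/-! ### Kraus operators that select and rescale entries -/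

section KrausMap

variable {ι κ σ : Type*} [Fintype ι] [Fintype κ] [Fintype σ]

/-- The map `X ↦ ∑ l, K l X (K l)†`. -/
def krausMap (K : σ → Matrix κ ι ℂ) : Matrix ι ι ℂ →ₗ[ℂ] Matrix κ κ ℂ where
  toFun X := ∑ l, K l * X * (K l).conjTranspose
  map_add' X Y := by simp [Matrix.mul_add, Matrix.add_mul, Finset.sum_add_distrib]
  map_smul' c X := by simp [Finset.smul_sum]

theorem krausMap_apply (K : σ → Matrix κ ι ℂ) (X : Matrix ι ι ℂ) :
    krausMap K X = ∑ l, K l * X * (K l).conjTranspose := rfl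

/-- The Kraus operator `K ⊗ 1`. -/
def ampliationKraus (K : Matrix κ ι ℂ) (k : ℕ) : Matrix (κ × Fin k) (ι × Fin k) ℂ :=
  Matrix.of fun a b => if a.2 = b.2 then K a.1 b.1 else 0

theorem ampliation_krausMap (K : σ → Matrix κ ι ℂ) (k : ℕ)
    (X : Matrix (ι × Fin k) (ι × Fin k) ℂ) :
    ampliation (krausMap K) k X = ∑ l, ampliationKraus (K l) k * X *
      (ampliationKraus (K l) k).conjTranspose := by
  ext ⟨p, s⟩ ⟨q, t⟩
  simp only [ampliation, krausMap_apply, Matrix.of_apply, Matrix.sum_apply]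
  refine Finset.sum_congr rfl fun l _ => ?_
  simp [ampliationKraus, Matrix.mul_apply, Fintype.sum_prod_type, Finset.sum_mul,
    apply_ite (starRingEnd ℂ)]

theorem isChannel_krausMap [DecidableEq ι] (K : σ → Matrix κ ι ℂ)
    (hK : ∑ l, (K l).conjTranspose * K l = 1) : IsChannel (krausMap K) where
  completelyPositive k X hX := by
    rw [ampliation_krausMap]
    exact Matrix.posSemidef_sum _ fun l _ => hX.mul_mul_conjTranspose_same _
  tracePreserving X := by
    rw [krausMap_apply, Matrix.trace_sum]
    simp_rw [Matrix.trace_mul_cycle _ X]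
    rw [← Matrix.trace_sum, ← Finset.sum_mul, hK, one_mul]

theorem isKrausDecomposition_krausMap (K : σ → Matrix κ ι ℂ) :
    IsKrausDecomposition (K ∘ (Fintype.equivFin σ).symm) (krausMap K) := fun X =>
  ((Fintype.equivFin σ).symm.sum_comp fun l => K l * X * (K l).conjTranspose).symm

variable [DecidableEq ι] [DecidableEq κ]

/-- The matrix `∑ j, c j |j⟩⟨f j|`. -/
def selectKraus (f : κ → ι) (c : κ → ℂ) : Matrix κ ι ℂ :=
  Matrix.of fun j i => if i = f j then c j else 0

theorem selectKraus_mul_mul_conjTranspose_apply (f : κ → ι) (c : κ → ℂ) (X : Matrix ι ι ℂ)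
    (j j' : κ) :
    (selectKraus f c * X * (selectKraus f c).conjTranspose) j j' =
      c j * X (f j) (f j') * star (c j') := by
  simp [selectKraus, Matrix.mul_apply, apply_ite (star : ℂ → ℂ)]

theorem conjTranspose_selectKraus_mul_apply (f : κ → ι) (c : κ → ℂ) (i i' : ι) :
    ((selectKraus f c).conjTranspose * selectKraus f c) i i' =
      if i = i' then ((∑ j, if f j = i then ‖c j‖ ^ 2 else 0 : ℝ) : ℂ) else 0 := by
  simp only [selectKraus, Matrix.mul_apply, Matrix.conjTranspose_apply, Matrix.of_apply]
  split_ifs with h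
  · subst h
    push_cast
    refine Finset.sum_congr rfl fun j _ => ?_
    by_cases hj : i = f j
    · simp [hj, ← Complex.normSq_eq_conj_mul_self, Complex.normSq_eq_norm_sq]
    · simp [hj, Ne.symm hj]
  · refine Finset.sum_eq_zero fun j _ => ?_
    by_cases hj : i = f j
    · have : i' ≠ f j := fun h' => h (hj.trans h'.symm)
      simp [this]
    · simp [hj]

theorem isIncoherentKraus_selectKraus {f : κ → ι} (hf : f.Injective) (c : κ → ℂ) :
    IsIncoherentKraus (selectKraus f c) := by
  refine .of_diagonal fun ω hω j j' hj => ?_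
  rw [selectKraus_mul_mul_conjTranspose_apply, hω _ _ (hf.ne hj)]
  simp

/-- The adjoint sends each `|j⟩` to a multiple of the single basis vector `|f j⟩`, so `f` need not
be injective here. -/
theorem isIncoherentKraus_conjTranspose_selectKraus (f : κ → ι) (c : κ → ℂ) :
    IsIncoherentKraus (selectKraus f c).conjTranspose := by
  refine .of_diagonal fun ω hω i i' hi => ?_
  rw [Matrix.conjTranspose_conjTranspose, Matrix.mul_apply]
  refine Finset.sum_eq_zero fun j _ => ?_
  rw [Matrix.mul_apply, Finset.sum_mul]
  refine Finset.sum_eq_zero fun j' _ => ?_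
  by_cases hj : j' = j
  · subst hj
    by_cases h1 : i = f j'
    · have : i' ≠ f j' := fun h' => hi (h1.trans h'.symm)
      simp [selectKraus, this]
    · simp [selectKraus, h1]
  · simp [hω _ _ hj]

/-- One construction serves all classes. Output entry `(j, j')` comes only from input entry `(f j, f
j')`, so injectivity keeps diagonal and off-diagonal parts apart. Each `K†K` is diagonal, and `hc`
says that these diagonals add up to the identity. -/
theorem FreeClass.contains_krausMap_selectKraus (O : FreeClass) {f : σ → κ → ι}
    (hf : ∀ l, (f l).Injective) {c : σ → κ → ℂ}
    (hc : ∀ i, ∑ l, ∑ j, (if f l j = i then ‖c l j‖ ^ 2 else 0) = 1) :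
    O.Contains (krausMap fun l => selectKraus (f l) (c l)) := by
  have hch : IsChannel (krausMap fun l => selectKraus (f l) (c l)) := by
    refine isChannel_krausMap _ ?_
    ext i i'
    rw [Matrix.sum_apply]
    simp_rw [conjTranspose_selectKraus_mul_apply]
    by_cases h : i = i'
    · subst h
      simp only [if_true, Matrix.one_apply_eq]
      rw [← Complex.ofReal_sum, hc, Complex.ofReal_one]
    · simp [h]
  have hio : FreeClass.incoherent.Contains (krausMap fun l => selectKraus (f l) (c l)) :=
    ⟨hch, _, _, isKrausDecomposition_krausMap _,
      fun l => isIncoherentKraus_selectKraus (hf _) _⟩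
  cases O with
  | maximallyIncoherent => exact ⟨hch, fun ω hω => hio.isIncoherent_apply hω⟩
  | dephasingCovariant =>
    refine ⟨hch, fun X => ?_⟩
    ext j j'
    rw [krausMap_apply, krausMap_apply, Matrix.sum_apply]
    simp_rw [selectKraus_mul_mul_conjTranspose_apply]
    by_cases h : j = j'
    · subst h
      simp [dephase, Matrix.sum_apply, selectKraus_mul_mul_conjTranspose_apply]
    · simp [dephase, h, (hf _).eq_iff]
  | incoherent => exact hio
  | strictlyIncoherent =>
    exact ⟨hch, _, _, isKrausDecomposition_krausMap _,
      fun l => ⟨isIncoherentKraus_selectKraus (hf _) _,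
        isIncoherentKraus_conjTranspose_selectKraus _ _⟩⟩

end KrausMap

/-! ### Achievability: exact distillation from bounded populations -/

section Distillation

/-- A probability vector bounded by `1 / m` is the average distribution of the `m` entries of a
random injective list. -/
theorem exists_perm_weights {ι : Type*} [Fintype ι] [DecidableEq ι] {q : ι → ℝ} (h1 : ∑ i, q i = 1)
    (h0 : ∀ i, 0 ≤ q i) {m : ℕ} (hm : 1 ≤ m) (hq : ∀ i, q i ≤ 1 / m) :
    ∃ (g : Fin m ↪ ι) (w : Equiv.Perm ι → ℝ), (∀ π, 0 ≤ w π) ∧ ∑ π, w π = 1 ∧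
      ∀ j i, ∑ π, (if π (g j) = i then w π else 0) = q i := by
  have hm0 : (0 : ℝ) < m := by exact_mod_cast hm
  have hq' : ∀ i, 0 ≤ 1 - m * q i := fun i => by
    have := mul_le_mul_of_nonneg_left (hq i) hm0.le
    rw [mul_one_div_cancel hm0.ne'] at this
    linarith
  have hsum : ∑ i, (1 - m * q i) = Fintype.card ι - m := by
    rw [Finset.sum_sub_distrib, ← Finset.mul_sum, h1]
    simp
  have hcard : m ≤ Fintype.card ι := by
    have := Finset.sum_nonneg fun i (_ : i ∈ Finset.univ) => hq' i
    rw [hsum, sub_nonneg] at this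
    exact_mod_cast this
  obtain ⟨g⟩ : Nonempty (Fin m ↪ ι) := Function.Embedding.nonempty_of_card_le (by simpa using hcard)
  classical
  -- `m` rows equal `q` and the other rows share equally what each column still lacks. The bound `q
  -- ≤ 1 / m` makes these entries nonnegative, so Birkhoff's theorem applies.
  let D : Matrix ι ι ℝ := Matrix.of fun k i =>
    if k ∈ Set.range g then q i else (1 - m * q i) / (Fintype.card ι - m)
  have hrange : (Finset.univ.filter fun k => k ∈ Set.range g).card = m := by
    have : (Finset.univ.filter fun k => k ∈ Set.range g) = Finset.univ.map g := by
      ext k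
      simp
    rw [this, Finset.card_map, Finset.card_univ, Fintype.card_fin]
  have hcompl : ((Finset.univ.filter fun k => ¬ k ∈ Set.range g).card : ℝ) =
      Fintype.card ι - m := by
    have := Finset.card_filter_add_card_filter_not (s := Finset.univ) fun k => k ∈ Set.range g
    rw [hrange, Finset.card_univ] at this
    rw [← this]
    push_cast
    ring
  have hD : D ∈ doublyStochastic ℝ ι := by
    rw [mem_doublyStochastic_iff_sum]
    refine ⟨fun k i => ?_, fun k => ?_, fun i => ?_⟩
    · simp only [D, Matrix.of_apply]
      split_ifs
      · exact h0 i
      · exact div_nonneg (hq' i) (sub_nonneg.2 (by exact_mod_cast hcard))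
    · simp only [D, Matrix.of_apply]
      split_ifs with h
      · exact h1
      · rw [← Finset.sum_div, hsum, div_self]
        rw [← hcompl, Nat.cast_ne_zero]
        exact Finset.card_ne_zero_of_mem (a := k) (by simpa using h)
    · simp only [D, Matrix.of_apply]
      rw [Finset.sum_ite, Finset.sum_const, Finset.sum_const, hrange, nsmul_eq_mul, nsmul_eq_mul,
        hcompl]
      -- With no remaining rows the quotient in `D` is the default `0`, but then every `q i` equals
      -- `1 / m`.
      by_cases hdm : (Fintype.card ι - m : ℝ) = 0
      · rw [hdm] at hsum ⊢
        have := (Finset.sum_eq_zero_iff_of_nonneg fun i _ => hq' i).1 hsum i (Finset.mem_univ i)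
        linarith
      · rw [mul_div_cancel₀ _ hdm]
        ring
  obtain ⟨w, hw0, hw1, hw⟩ := exists_eq_sum_perm_of_mem_doublyStochastic hD
  refine ⟨g, w, hw0, hw1, fun j i => ?_⟩
  have := congrFun (congrFun hw (g j)) i
  simp only [D, Matrix.of_apply, Set.mem_range_self, if_true] at this
  rw [← this, Matrix.sum_apply]
  refine Finset.sum_congr rfl fun π _ => ?_
  simp [Equiv.Perm.permMatrix, PEquiv.toMatrix_apply, Equiv.toPEquiv_apply, eq_comm]

/-- The branch of `π` divides out the amplitudes of `ψ` at the labels `π (g j)`, leaving `√(w π)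
Ψ_m`. Since the marginals of `w` are exactly the populations, these branches satisfy completeness on
the support of `ψ`. -/
theorem exists_contains_apply_eq_maxCoherent {ι : Type*} [Fintype ι] [DecidableEq ι]
    (O : FreeClass) {ψ : ι → ℂ} (hψ : IsUnitVector ψ) {m : ℕ} (hm : 1 ≤ m)
    (hc : ∀ i, ‖ψ i‖ ^ 2 ≤ 1 / m) :
    ∃ Λ : Matrix ι ι ℂ →ₗ[ℂ] Matrix (Fin m) (Fin m) ℂ,
      O.Contains Λ ∧ Λ (ketbra ψ) = ketbra (maxCoherent m) := by
  obtain ⟨g, w, hw0, hw1, hw⟩ := exists_perm_weights hψ (fun i => by positivity) hm hc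
  have hm0 : (0 : ℝ) < m := by exact_mod_cast hm
  let j₀ : Fin m := ⟨0, hm⟩
  -- The second summand supplies operators `|j₀⟩⟨k|` for `k` outside the support of `ψ`; they
  -- restore trace preservation and annihilate `ψ`. The swap merely extends `j₀ ↦ k` to an injective
  -- selection.
  let f : Equiv.Perm ι ⊕ ι → Fin m → ι :=
    Sum.elim (fun π j => π (g j)) fun k j => Equiv.swap (g j₀) k (g j)
  let c : Equiv.Perm ι ⊕ ι → Fin m → ℂ :=
    Sum.elim (fun π j => (√(w π) * (1 / √m) : ℝ) * (ψ (π (g j)))⁻¹)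
      fun k j => if j = j₀ ∧ ψ k = 0 then 1 else 0
  have hf : ∀ l, (f l).Injective := by
    rintro (π | k)
    · exact π.injective.comp g.injective
    · exact (Equiv.swap (g j₀) k).injective.comp g.injective
  refine ⟨krausMap fun l => selectKraus (f l) (c l), O.contains_krausMap_selectKraus hf ?_, ?_⟩
  · intro i
    rw [Fintype.sum_sum_type]
    have e1 : ∑ π, ∑ j, (if f (.inl π) j = i then ‖c (.inl π) j‖ ^ 2 else 0) =
        if ψ i = 0 then 0 else 1 := by
      have : ∀ π j, (if f (.inl π) j = i then ‖c (.inl π) j‖ ^ 2 else 0) =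
          (1 / m * (‖ψ i‖ ^ 2)⁻¹) * if π (g j) = i then w π else 0 := by
        intro π j
        change (if π (g j) = i then _ else _) = _
        split_ifs with h
        · simp only [c, Sum.elim_inl]
          rw [h, norm_mul, mul_pow, Complex.norm_real, norm_inv, inv_pow, Real.norm_eq_abs, sq_abs,
            mul_pow, Real.sq_sqrt (hw0 π), div_pow, Real.sq_sqrt hm0.le]
          ring
        · simp
      simp_rw [this, ← Finset.mul_sum]
      rw [Finset.sum_comm]
      simp_rw [hw]
      split_ifs with h
      · simp [h]
      · have : ‖ψ i‖ ≠ 0 := norm_ne_zero_iff.2 h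
        simp only [Finset.sum_const, Finset.card_univ, Fintype.card_fin, nsmul_eq_mul]
        field_simp
    have e2 : ∑ k, ∑ j, (if f (.inr k) j = i then ‖c (.inr k) j‖ ^ 2 else 0) =
        if ψ i = 0 then 1 else 0 := by
      rw [Finset.sum_eq_single i]
      · rw [Finset.sum_eq_single j₀]
        · by_cases h : ψ i = 0 <;> simp [f, c, h]
        · intro j _ hj
          simp [c, hj]
        · simp
      · intro k _ hk
        refine Finset.sum_eq_zero fun j _ => ?_
        by_cases hj : j = j₀
        · subst hj
          simp [f, hk]
        · simp [c, hj]
      · simp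
    rw [e1, e2]
    split_ifs <;> simp
  · have hcψ : ∀ π j, c (.inl π) j * ψ (f (.inl π) j) = (√(w π) * (1 / √m) : ℝ) := by
      intro π j
      simp only [f, c, Sum.elim_inl]
      by_cases h : ψ (π (g j)) = 0
      · have hz : w π = 0 := by
          have := hw j (π (g j))
          rw [h, norm_zero, zero_pow two_ne_zero, Finset.sum_eq_zero_iff_of_nonneg
            (fun π _ => by split_ifs; exacts [hw0 π, le_rfl])] at this
          simpa using this π (Finset.mem_univ π)
        simp [hz, h]
      · rw [mul_assoc, inv_mul_cancel₀ h, mul_one]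
    have hcψ' : ∀ k j, c (.inr k) j * ψ (f (.inr k) j) = 0 := by
      intro k j
      by_cases h : j = j₀ ∧ ψ k = 0
      · obtain ⟨rfl, hk⟩ := h
        simp [f, hk]
      · simp [c, h]
    ext j j'
    have e : ∀ l, (selectKraus (f l) (c l) * ketbra ψ * (selectKraus (f l) (c l)).conjTranspose)
        j j' = (c l j * ψ (f l j)) * star (c l j' * ψ (f l j')) := by
      intro l
      rw [selectKraus_mul_mul_conjTranspose_apply, ketbra_apply, star_mul']
      ring
    rw [krausMap_apply, Matrix.sum_apply, Fintype.sum_sum_type]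
    simp_rw [e, hcψ, hcψ']
    have e' : ∀ π, ((√(w π) * (1 / √m) : ℝ) : ℂ) * star ((√(w π) * (1 / √m) : ℝ) : ℂ) =
        ((w π * (1 / m) : ℝ) : ℂ) := by
      intro π
      rw [Complex.star_def, Complex.conj_ofReal, ← Complex.ofReal_mul]
      congr 1
      rw [mul_mul_mul_comm, Real.mul_self_sqrt (hw0 π), div_mul_div_comm,
        Real.mul_self_sqrt hm0.le, one_mul]
    simp_rw [e']
    rw [← Complex.ofReal_sum, ← Finset.sum_mul, hw1, ketbra_apply]
    simp only [maxCoherent]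
    rw [Complex.star_def, Complex.conj_ofReal, ← Complex.ofReal_mul, div_mul_div_comm,
      Real.mul_self_sqrt hm0.le]
    simp

theorem isUnitVector_maxCoherent {m : ℕ} (hm : 1 ≤ m) : IsUnitVector (maxCoherent m) := by
  have hm0 : (0 : ℝ) < m := by exact_mod_cast hm
  simp [IsUnitVector, maxCoherent, Real.sq_sqrt hm0.le, hm0.ne']

theorem IsMixtureOfBounded.one_mem_achievableFidelities {ι : Type*} [Fintype ι] [DecidableEq ι]
    (O : FreeClass) {ρ : Matrix ι ι ℂ} {m : ℕ} (hm : 1 ≤ m)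
    (hρ : IsMixtureOfBounded (1 / m) ρ) : 1 ∈ achievableFidelities O ρ m := by
  obtain ⟨r, p, ψ, hdec, hc⟩ := hρ.exists_isPureDecomposition
  choose Λ hΛ hΛψ using fun k => exists_contains_apply_eq_maxCoherent O (hdec.unit k) hm (hc k)
  refine ⟨r, p, ψ, Λ, hdec, hΛ, ?_⟩
  simp_rw [hΛψ]
  have h1 : ∑ i, (p i : ℂ) = 1 := by exact_mod_cast hdec.sum_eq_one
  have hdot : star (maxCoherent m) ⬝ᵥ maxCoherent m = 1 := by
    have := (isUnitVector_maxCoherent hm).isDensityMatrix.trace_eq_one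
    rwa [ketbra, Matrix.trace_vecMulVec, dotProduct_comm] at this
  rw [← Finset.sum_smul, h1, one_smul, hsInner, (posSemidef_ketbra _).isHermitian.eq, ketbra,
    Matrix.vecMulVec_mul_vecMulVec, hdot, one_smul, Matrix.trace_vecMulVec,
    dotProduct_comm, hdot]
  simp

end Distillation

/-! ### Converse: fidelity one forces bounded populations -/

section Fidelity

variable {ι : Type*} [Fintype ι]

/-- The real-linear functional `X ↦ Re ⟨X, Ψ_m⟩`. -/
noncomputable def fidelityWith (m : ℕ) : Matrix (Fin m) (Fin m) ℂ →ₗ[ℝ] ℝ where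
  toFun X := 1 / m * ∑ j, ∑ j', (X j j').re
  map_add' X Y := by simp [Finset.sum_add_distrib, mul_add]
  map_smul' r X := by
    simp [← Finset.mul_sum]
    ring

theorem fidelityWith_apply {m : ℕ} (X : Matrix (Fin m) (Fin m) ℂ) :
    fidelityWith m X = 1 / m * ∑ j, ∑ j', (X j j').re := rfl

theorem re_hsInner_maxCoherent {m : ℕ} (X : Matrix (Fin m) (Fin m) ℂ) :
    (hsInner X (ketbra (maxCoherent m))).re = fidelityWith m X := by
  have h : ∀ i j, ketbra (maxCoherent m) i j = ((1 / m : ℝ) : ℂ) := by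
    intro i j
    rw [ketbra_apply]
    simp only [maxCoherent]
    rw [Complex.star_def, Complex.conj_ofReal, ← Complex.ofReal_mul, div_mul_div_comm,
      Real.mul_self_sqrt (Nat.cast_nonneg m), one_mul]
  simp only [hsInner, Matrix.trace, Matrix.diag_apply, Matrix.mul_apply, h,
    Matrix.conjTranspose_apply, Complex.re_sum, Complex.re_mul_ofReal, fidelityWith_apply]
  rw [Finset.sum_comm, Finset.mul_sum]
  refine Finset.sum_congr rfl fun j _ => ?_
  rw [Finset.mul_sum]
  refine Finset.sum_congr rfl fun j' _ => ?_
  simp [mul_comm]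

theorem fidelityWith_ketbra {m : ℕ} (b : Fin m → ℂ) :
    fidelityWith m (ketbra b) = 1 / m * ‖∑ j, b j‖ ^ 2 := by
  rw [fidelityWith_apply]
  congr 1
  have h : ((‖∑ j, b j‖ ^ 2 : ℝ) : ℂ) = ∑ j, ∑ j', ketbra b j j' := by
    simp_rw [ketbra_apply, ← Finset.mul_sum, ← Finset.sum_mul, ← star_sum]
    rw [Complex.star_def, Complex.mul_conj, Complex.normSq_eq_norm_sq]
  have := congrArg Complex.re h
  rw [Complex.ofReal_re] at this
  simpa only [Complex.re_sum] using this.symm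

theorem fidelityWith_nonneg {m : ℕ} {X : Matrix (Fin m) (Fin m) ℂ} (hX : X.PosSemidef) :
    0 ≤ fidelityWith m X := by
  obtain ⟨r, b, rfl⟩ := exists_eq_sum_ketbra hX
  rw [map_sum]
  refine Finset.sum_nonneg fun k _ => ?_
  rw [fidelityWith_ketbra]
  positivity

theorem fidelityWith_le_trace {m : ℕ} (hm : 1 ≤ m) {X : Matrix (Fin m) (Fin m) ℂ}
    (hX : X.PosSemidef) : fidelityWith m X ≤ X.trace.re := by
  have hm0 : (0 : ℝ) < m := by exact_mod_cast hm
  obtain ⟨r, b, rfl⟩ := exists_eq_sum_ketbra hX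
  rw [map_sum, Matrix.trace_sum, Complex.re_sum]
  refine Finset.sum_le_sum fun k _ => ?_
  rw [fidelityWith_ketbra, trace_ketbra, Complex.ofReal_re, one_div, inv_mul_le_iff₀ hm0]
  calc ‖∑ j, b k j‖ ^ 2 ≤ (∑ j, ‖b k j‖) ^ 2 := by
        gcongr
        exact norm_sum_le _ _
    _ ≤ _ := by simpa using sq_sum_le_card_mul_sum_sq (s := Finset.univ) (f := fun j => ‖b k j‖)

/-- The Hermitian matrix `|x⟩⟨y| + |y⟩⟨x|`. -/
def crossTerm (x y : ι → ℂ) : Matrix ι ι ℂ :=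
  Matrix.vecMulVec x (star y) + Matrix.vecMulVec y (star x)

/-- Cauchy-Schwarz for the form `h`, with the optimisation over `t` left open: expand `h` at the
vector `x - t y`. -/
theorem crossTerm_le {h : Matrix ι ι ℂ →ₗ[ℝ] ℝ} (hpos : ∀ v, 0 ≤ h (ketbra v)) (x y : ι → ℂ)
    {t : ℝ} (ht : 0 < t) : h (crossTerm x y) ≤ h (ketbra x) / t + t * h (ketbra y) := by
  have e : ketbra (fun i => x i - t * y i) =
      ketbra x + (t ^ 2) • ketbra y - t • crossTerm x y := by
    ext i j
    simp [ketbra_apply, crossTerm, Matrix.vecMulVec_apply]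
    ring
  have := hpos fun i => x i - t * y i
  rw [e, map_sub, map_add, map_smul, map_smul, smul_eq_mul, smul_eq_mul] at this
  rw [div_add' _ _ _ ht.ne', le_div_iff₀ ht]
  linarith

variable [DecidableEq ι]

theorem ketbra_single {i : ι} {ω : ℂ} (hω : ‖ω‖ = 1) :
    ketbra (Pi.single i ω) = Matrix.single i i (1 : ℂ) := by
  ext j k
  rw [ketbra_apply, Matrix.single_apply]
  by_cases hj : i = j
  · subst hj
    by_cases hk : i = k
    · subst hk
      simp [Complex.mul_conj, Complex.normSq_eq_norm_sq, hω]
    · simp [hk, Ne.symm hk]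
  · simp [Pi.single_apply, hj, Ne.symm hj]

theorem isUnitVector_single {i : ι} {ω : ℂ} (hω : ‖ω‖ = 1) : IsUnitVector (Pi.single i ω) := by
  unfold IsUnitVector
  rw [Finset.sum_eq_single i] <;> simp +contextual [hω]

theorem isIncoherent_single (i : ι) : IsIncoherent (Matrix.single i i (1 : ℂ)) where
  isDensityMatrix := by
    rw [← ketbra_single (ω := 1) (by simp)]
    exact (isUnitVector_single (by simp)).isDensityMatrix
  eq_dephase := eq_dephase_iff.2 fun j k hjk => by
    rw [Matrix.single_apply, if_neg]
    rintro ⟨rfl, rfl⟩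
    exact hjk rfl

theorem IsIncoherent.fidelityWith_eq {m : ℕ} {X : Matrix (Fin m) (Fin m) ℂ} (hX : IsIncoherent X) :
    fidelityWith m X = 1 / m := by
  have h : ∀ j, ∑ j', (X j j').re = (X j j).re := fun j =>
    Finset.sum_eq_single_of_mem j (Finset.mem_univ j) fun j' _ hj => by
      rw [eq_dephase_iff.1 hX.eq_dephase j j' hj.symm, Complex.zero_re]
  have htr := congrArg Complex.re hX.isDensityMatrix.trace_eq_one
  rw [Matrix.trace, Complex.re_sum] at htr
  simp only [Matrix.diag_apply, Complex.one_re] at htr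
  rw [fidelityWith_apply]
  simp_rw [h]
  rw [htr, mul_one]

/-- Any free operation that takes `ψ` to a state of fidelity `s` with `Ψ_m` forces the
populations of `ψ` to be at most about `1 / m`. -/
theorem FreeClass.Contains.norm_apply_le {O : FreeClass} {m : ℕ} (hm : 1 ≤ m)
    {Λ : Matrix ι ι ℂ →ₗ[ℂ] Matrix (Fin m) (Fin m) ℂ} (hΛ : O.Contains Λ) {ψ : ι → ℂ}
    (hψ : IsUnitVector ψ) (i : ι) :
    ‖ψ i‖ ≤ 1 / √m + √(1 - fidelityWith m (Λ (ketbra ψ))) := by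
  have hm0 : (0 : ℝ) < m := by exact_mod_cast hm
  let f : Matrix ι ι ℂ →ₗ[ℝ] ℝ := fidelityWith m ∘ₗ Λ.restrictScalars ℝ
  let tr : Matrix ι ι ℂ →ₗ[ℝ] ℝ :=
    Complex.reLm ∘ₗ (Matrix.traceLinearMap ι ℂ ℂ).restrictScalars ℝ
  have htr : ∀ X, tr X = X.trace.re := fun X => rfl
  have hf : ∀ X, f X = fidelityWith m (Λ X) := fun X => rfl
  have hf0 : ∀ v, 0 ≤ f (ketbra v) := fun v =>
    fidelityWith_nonneg (hΛ.isChannel.posSemidef_apply (posSemidef_ketbra v))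
  have hg0 : ∀ v, 0 ≤ (tr - f) (ketbra v) := fun v => by
    rw [LinearMap.sub_apply, sub_nonneg, htr, ← hΛ.isChannel.tracePreserving]
    exact fidelityWith_le_trace hm (hΛ.isChannel.posSemidef_apply (posSemidef_ketbra v))
  set s := fidelityWith m (Λ (ketbra ψ)) with hs
  have htrψ : tr (ketbra ψ) = 1 := by
    rw [htr, hψ.isDensityMatrix.trace_eq_one, Complex.one_re]
  have hs1 : s ≤ 1 := by
    have := hg0 ψ
    rw [LinearMap.sub_apply, htrψ, hf] at this
    linarith
  -- The phase of `ψ i` makes the overlap of `ψ` with `y = ω|i⟩` real and equal to `|ψ i|`.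
  obtain ⟨ω, hω, hωψ⟩ : ∃ ω : ℂ, ‖ω‖ = 1 ∧ (ψ i * star ω).re = ‖ψ i‖ := by
    by_cases h : ψ i = 0
    · exact ⟨1, by simp, by simp [h]⟩
    · have h' : (‖ψ i‖ : ℂ) ≠ 0 := by simpa using h
      refine ⟨ψ i / ‖ψ i‖, by simp [h], ?_⟩
      have : ψ i * star (ψ i / ‖ψ i‖) = (‖ψ i‖ : ℂ) := by
        rw [star_div₀, Complex.star_def, Complex.conj_ofReal, mul_div_assoc',
          Complex.mul_conj, Complex.normSq_eq_norm_sq]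
        field_simp
        push_cast
        ring
      rw [this, Complex.ofReal_re]
  let y : ι → ℂ := Pi.single i ω
  have hfy : f (ketbra y) = 1 / m := by
    rw [hf, ketbra_single hω]
    exact (hΛ.isIncoherent_apply (isIncoherent_single i)).fidelityWith_eq
  have htry : tr (ketbra y) = 1 := by
    rw [htr, (isUnitVector_single hω).isDensityMatrix.trace_eq_one, Complex.one_re]
  have htrC : tr (crossTerm ψ y) = 2 * ‖ψ i‖ := by
    rw [htr, crossTerm, Matrix.trace_add, Matrix.trace_vecMulVec, Matrix.trace_vecMulVec]
    have e1 : ψ ⬝ᵥ star y = ψ i * star ω := by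
      simp [y, dotProduct, Pi.single_apply, apply_ite (starRingEnd ℂ)]
    have e2 : y ⬝ᵥ star ψ = star (ψ i * star ω) := by
      rw [← e1, ← Matrix.star_dotProduct_star, star_star, dotProduct_comm]
    have e3 : (star (ψ i * star ω)).re = ‖ψ i‖ := (Complex.conj_re _).trans hωψ
    rw [e1, e2, Complex.add_re, e3, hωψ]
    ring
  have hsm : 0 < √(m : ℝ) := Real.sqrt_pos.2 hm0
  -- Split the trace as `f + (tr - f)`, both nonnegative on rank-one operators. As `f` is `1 / m` at
  -- `y`, the choice `t = √m` bounds the first part by `2 / √m`. The second part is optimised by `u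
  -- = √(1 - s)`, or by `u → 0` when `s = 1`.
  have key : ∀ u : ℝ, 0 < u → 2 * ‖ψ i‖ ≤ 2 / √m + ((1 - s) / u + u) := by
    intro u hu
    have h1 := crossTerm_le hf0 ψ y hsm
    have h2 := crossTerm_le hg0 ψ y hu
    simp only [LinearMap.sub_apply, htrψ, htry, htrC, hfy] at h1 h2
    rw [hf (ketbra ψ), ← hs] at h1 h2
    have h3 : √(m : ℝ) * (1 / m) = 1 / √m := by
      rw [mul_one_div, Real.sqrt_div_self']
    have h4 : s / √m ≤ 1 / √m := by gcongr
    have h5 : u * (1 - 1 / m) ≤ u := by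
      have : (0 : ℝ) ≤ 1 / m := by positivity
      nlinarith
    rw [h3] at h1
    have h6 : 2 / √(m : ℝ) = 1 / √m + 1 / √m := by ring
    linarith
  rcases hs1.eq_or_lt with h | h
  · rw [h, sub_self, Real.sqrt_zero, add_zero]
    refine le_of_forall_pos_le_add fun ε hε => ?_
    have := key ε hε
    rw [h, sub_self, zero_div, zero_add] at this
    have h6 : 2 / √(m : ℝ) = 1 / √m + 1 / √m := by ring
    linarith
  · have hpos : 0 < √(1 - s) := Real.sqrt_pos.2 (by linarith)
    have := key _ hpos
    rw [Real.div_sqrt] at this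
    have h6 : 2 / √(m : ℝ) = 1 / √m + 1 / √m := by ring
    linarith

/-- Pairs of a pure state and a fidelity that are compatible with the population bound. -/
def fidelityPairs (ι : Type*) [Fintype ι] (m : ℕ) : Set (Matrix ι ι ℂ × ℝ) :=
  (fun q : (ι → ℂ) × ℝ => (ketbra q.1, q.2)) ''
    ({ψ | IsUnitVector ψ} ×ˢ Set.Icc 0 1 ∩ {q | ∀ i, ‖q.1 i‖ ≤ 1 / √m + √(1 - q.2)})

theorem isCompact_fidelityPairs (m : ℕ) : IsCompact (fidelityPairs ι m) := by
  refine ((isCompact_setOf_isUnitVector.prod isCompact_Icc).inter_right ?_).image ?_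
  · simp only [Set.ofPred_forall]
    exact isClosed_iInter fun i => isClosed_le (by fun_prop) (by fun_prop)
  · exact (continuous_ketbra.comp continuous_fst).prodMk continuous_snd

theorem mem_convexHull_fidelityPairs {O : FreeClass} {ρ : Matrix ι ι ℂ} {m : ℕ} (hm : 1 ≤ m)
    {x : ℝ} (hx : x ∈ achievableFidelities O ρ m) :
    (ρ, x) ∈ convexHull ℝ (fidelityPairs ι m) := by
  obtain ⟨r, p, ψ, Λ, hdec, hΛ, rfl⟩ := hx
  refine mem_convexHull_of_exists_fintype p
    (fun k => (ketbra (ψ k), fidelityWith m (Λ k (ketbra (ψ k))))) hdec.nonneg hdec.sum_eq_one ?_ ?_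
  · intro k
    have hpos := (hΛ k).isChannel.isDensityMatrix_apply (hdec.unit k).isDensityMatrix
    refine ⟨(ψ k, _), ⟨⟨hdec.unit k, fidelityWith_nonneg hpos.posSemidef, ?_⟩,
      fun i => (hΛ k).norm_apply_le hm (hdec.unit k) i⟩, rfl⟩
    have := fidelityWith_le_trace hm hpos.posSemidef
    rwa [hpos.trace_eq_one, Complex.one_re] at this
  · rw [re_hsInner_maxCoherent]
    ext1
    · rw [Prod.fst_sum, hdec.eq_sum]
      simp [Complex.coe_smul]
    · rw [Prod.snd_sum]
      simp [Complex.coe_smul]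

theorem le_one_of_mem_convexHull_fidelityPairs {ρ : Matrix ι ι ℂ} {m : ℕ} {x : ℝ}
    (hx : (ρ, x) ∈ convexHull ℝ (fidelityPairs ι m)) : x ≤ 1 := by
  refine convexHull_min (t := LinearMap.snd ℝ (Matrix ι ι ℂ) ℝ ⁻¹' Set.Iic 1) ?_
    ((convex_Iic 1).linear_preimage _) hx
  rintro _ ⟨q, ⟨⟨-, hq⟩, -⟩, rfl⟩
  exact hq.2

/-- No fidelity exceeds one, so an average of at least one forces fidelity one on every term of
positive weight, where the error in the population bound vanishes. Terms of weight zero are dropped,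
being unconstrained. -/
theorem isMixtureOfBounded_of_mem_convexHull {ρ : Matrix ι ι ℂ} {m : ℕ} {x : ℝ} (h1 : 1 ≤ x)
    (hx : (ρ, x) ∈ convexHull ℝ (fidelityPairs ι m)) : IsMixtureOfBounded (1 / m) ρ := by
  obtain ⟨κ, _, w, z, hw0, hw1, hz, hsum⟩ := mem_convexHull_iff_exists_fintype.1 hx
  have hz1 : ∀ k, (z k).2 ≤ 1 := fun k => by
    obtain ⟨q, ⟨⟨-, hq⟩, -⟩, hqz⟩ := hz k
    rw [← hqz]
    exact hq.2
  have hsum2 : ∑ k, w k * (1 - (z k).2) ≤ 0 := by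
    have := congrArg Prod.snd hsum
    rw [Prod.snd_sum] at this
    simp only [Prod.smul_snd, smul_eq_mul] at this
    simp_rw [mul_sub, mul_one, Finset.sum_sub_distrib, hw1, this]
    linarith
  have hnn : ∀ k ∈ Finset.univ, 0 ≤ w k * (1 - (z k).2) := fun k _ =>
    mul_nonneg (hw0 k) (sub_nonneg.2 (hz1 k))
  have hzero := (Finset.sum_eq_zero_iff_of_nonneg hnn).1 (hsum2.antisymm (Finset.sum_nonneg hnn))
  have hρ : ∑ k with w k ≠ 0, w k • (z k).1 = ρ := by
    rw [Finset.sum_filter_of_ne (p := fun k => w k ≠ 0)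
      fun k _ hk h => hk (by rw [h, zero_smul])]
    have := congrArg Prod.fst hsum
    rwa [Prod.fst_sum] at this
  rw [IsMixtureOfBounded, ← hρ]
  refine (convex_convexHull ℝ _).sum_mem (fun k _ => hw0 k) ?_ fun k hk => subset_convexHull ℝ _ ?_
  · rw [Finset.sum_filter_ne_zero, hw1]
  · obtain ⟨q, ⟨⟨hq, -⟩, hqb⟩, hqz⟩ := hz k
    have hk1 : q.2 = 1 := by
      have := (mul_eq_zero.1 (hzero k (Finset.mem_univ k))).resolve_left (by simpa using hk)
      rw [← hqz] at this
      exact (sub_eq_zero.1 this).symm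
    refine ⟨q.1, hq, fun i => ?_, by rw [← hqz]⟩
    have := hqb i
    rw [hk1, sub_self, Real.sqrt_zero, add_zero] at this
    calc ‖q.1 i‖ ^ 2 ≤ (1 / √(m : ℝ)) ^ 2 := by gcongr
      _ = 1 / (m : ℝ) := by rw [div_pow, Real.sq_sqrt (Nat.cast_nonneg m), one_pow]

/-- The supremum need not be known to be attained: the hull of `fidelityPairs` is closed and
contains all achievable pairs, hence also the limiting one. -/
theorem isMixtureOfBounded_of_one_le_assistedFidelity {O : FreeClass} {ρ : Matrix ι ι ℂ} {m : ℕ}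
    (hm : 1 ≤ m) (h : 1 ≤ assistedFidelity O ρ m) : IsMixtureOfBounded (1 / m) ρ := by
  refine isMixtureOfBounded_of_mem_convexHull h ?_
  have hclosed : IsClosed {x : ℝ | (ρ, x) ∈ convexHull ℝ (fidelityPairs ι m)} :=
    (isCompact_convexHull_of_finiteDimensional (isCompact_fidelityPairs m)).isClosed.preimage
      (Continuous.prodMk_right ρ)
  have hsub : achievableFidelities O ρ m ⊆ {x : ℝ | (ρ, x) ∈ convexHull ℝ (fidelityPairs ι m)} :=
    fun x hx => mem_convexHull_fidelityPairs hm hx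
  -- `sSup ∅ = 0` in `ℝ`, which contradicts `h`.
  have hne : (achievableFidelities O ρ m).Nonempty := by
    by_contra hempty
    rw [Set.not_nonempty_iff_eq_empty] at hempty
    rw [assistedFidelity, hempty, Real.sSup_empty] at h
    linarith
  exact closure_minimal hsub hclosed (csSup_mem_closure hne
    ⟨1, fun x hx => le_one_of_mem_convexHull_fidelityPairs (hsub hx)⟩)

theorem mem_distillableDims_iff {O : FreeClass} {ρ : Matrix ι ι ℂ} {m : ℕ} :
    m ∈ distillableDims O 0 ρ ↔ 1 ≤ m ∧ IsMixtureOfBounded (1 / m) ρ := by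
  rw [distillableDims, Set.mem_ofPred_eq, sub_zero]
  refine and_congr_right fun hm => ⟨isMixtureOfBounded_of_one_le_assistedFidelity hm, fun h => ?_⟩
  refine le_csSup ⟨1, fun x hx => ?_⟩ (h.one_mem_achievableFidelities O hm)
  exact le_one_of_mem_convexHull_fidelityPairs (mem_convexHull_fidelityPairs hm hx)

end Fidelity

/-! ### Extreme points with prescribed diagonal, dimension at most three -/

section LowDimension

variable {ι : Type*} [Fintype ι]

theorem isCompact_boundedPureStates (c : ℝ) : IsCompact (boundedPureStates ι c) := by
  have h : IsCompact ({ψ : ι → ℂ | IsUnitVector ψ} ∩ {ψ | ∀ i, ‖ψ i‖ ^ 2 ≤ c}) := by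
    refine isCompact_setOf_isUnitVector.inter_right ?_
    simp only [Set.ofPred_forall]
    exact isClosed_iInter fun i => isClosed_le (by fun_prop) continuous_const
  convert h.image continuous_ketbra using 1
  ext X
  simp [boundedPureStates, and_assoc]

/-- The Hermitian matrices `a |u⟩⟨u| + b |w⟩⟨w| + c |u⟩⟨w| + c̄ |w⟩⟨u|` supported on the span of
`u` and `w`. -/
noncomputable def hermitianSpan (u w : ι → ℂ) : ℝ × ℝ × ℂ →ₗ[ℝ] Matrix ι ι ℂ where
  toFun x := x.1 • ketbra u + x.2.1 • ketbra w + crossTerm (x.2.2 • u) w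
  map_add' x y := by
    ext i j
    simp [crossTerm, ketbra_apply, Matrix.vecMulVec_apply]
    ring
  map_smul' r x := by
    ext i j
    simp [crossTerm, ketbra_apply, Matrix.vecMulVec_apply]
    ring

theorem hermitianSpan_apply (u w : ι → ℂ) (x : ℝ × ℝ × ℂ) : hermitianSpan u w x =
    x.1 • ketbra u + x.2.1 • ketbra w + crossTerm (x.2.2 • u) w := rfl

theorem hermitianSpan_injective {u w : ι → ℂ} (h : LinearIndependent ℂ ![u, w]) :
    Function.Injective (hermitianSpan u w) := by
  rw [LinearIndependent.pair_iff] at h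
  rw [injective_iff_map_eq_zero]
  rintro ⟨a, b, c⟩ hx
  have hX : ∀ j, (a : ℂ) * star (u j) + c * star (w j) = 0 ∧
      (b : ℂ) * star (w j) + star c * star (u j) = 0 := by
    intro j
    refine h _ _ ?_
    funext i
    have := congrFun (congrFun hx i) j
    simp [hermitianSpan_apply, crossTerm, ketbra_apply, Matrix.vecMulVec_apply] at this
    simp
    linear_combination this
  have h1 := h a (star c) <| by
    funext j
    have := congrArg star (hX j).1
    simpa [mul_comm] using this
  have h2 := h c b <| by
    funext j
    have := congrArg star (hX j).2
    simpa [mul_comm, add_comm] using this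
  simp only [Complex.ofReal_eq_zero] at h1 h2
  rw [h1.1, h2.1, h2.2]
  rfl

/-- Completing the square: `ε` times the projector on `c u + w` absorbs the cross terms, at the cost
of `ε ‖c‖²` and `ε` in the coefficients of `u` and `w`, which stay nonnegative. -/
theorem posSemidef_add_smul_hermitianSpan (u w : ι → ℂ) (x : ℝ × ℝ × ℂ) {ε : ℝ} (hε : 0 ≤ ε)
    (hx : ε * (|x.1| + |x.2.1| + ‖x.2.2‖ ^ 2 + 1) ≤ 1) :
    (ketbra u + ketbra w + ε • hermitianSpan u w x).PosSemidef := by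
  obtain ⟨a, b, c⟩ := x
  simp only at hx
  have e : ketbra u + ketbra w + ε • hermitianSpan u w (a, b, c) =
      (1 + ε * a - ε * ‖c‖ ^ 2) • ketbra u + (1 + ε * b - ε) • ketbra w +
        ε • ketbra (c • u + w) := by
    have hc : ((‖c‖ ^ 2 : ℝ) : ℂ) = c * star c := by
      simp [Complex.mul_conj, Complex.normSq_eq_norm_sq]
    ext i j
    simp only [hermitianSpan_apply, crossTerm, ketbra_apply, Matrix.vecMulVec_apply,
      Matrix.add_apply, Matrix.smul_apply, Pi.smul_apply, Pi.add_apply, Pi.star_apply,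
      Complex.real_smul, smul_eq_mul, star_add, star_mul', Complex.ofReal_add, Complex.ofReal_sub,
      Complex.ofReal_mul, Complex.ofReal_one, hc]
    ring
  have hm1 : ε * |a| ≤ 1 - ε * ‖c‖ ^ 2 := by
    have : 0 ≤ ε * (|b| + 1) := by positivity
    linarith
  have hm2 : ε * |b| ≤ 1 - ε := by
    have : 0 ≤ ε * (|a| + ‖c‖ ^ 2) := by positivity
    linarith
  have ha : 0 ≤ 1 + ε * a - ε * ‖c‖ ^ 2 := by
    have := mul_le_mul_of_nonneg_left (neg_abs_le a) hε
    linarith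
  have hb : 0 ≤ 1 + ε * b - ε := by
    have := mul_le_mul_of_nonneg_left (neg_abs_le b) hε
    linarith
  rw [e]
  exact (((posSemidef_ketbra u).smul ha).add ((posSemidef_ketbra w).smul hb)).add
    ((posSemidef_ketbra _).smul hε)

/-- The positive semidefinite matrices with the same diagonal as `ρ`. -/
def sameDiagonal (ρ : Matrix ι ι ℂ) : Set (Matrix ι ι ℂ) :=
  {σ | σ.PosSemidef ∧ ∀ i, σ i i = ρ i i}

theorem convex_sameDiagonal (ρ : Matrix ι ι ℂ) : Convex ℝ (sameDiagonal ρ) := by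
  rintro σ ⟨hσ, hσd⟩ τ ⟨hτ, hτd⟩ a b ha hb hab
  refine ⟨(hσ.smul ha).add (hτ.smul hb), fun i => ?_⟩
  rw [Matrix.add_apply, Matrix.smul_apply, Matrix.smul_apply, hσd, hτd, ← add_smul, hab, one_smul]

theorem norm_apply_le_of_posSemidef {σ : Matrix ι ι ℂ} (hσ : σ.PosSemidef) (i j : ι) :
    ‖σ i j‖ ≤ ((σ i i).re + (σ j j).re) / 2 := by
  obtain ⟨m, b, rfl⟩ := exists_eq_sum_ketbra hσ
  simp only [Matrix.sum_apply, Complex.re_sum, ketbra_diag, Complex.ofReal_re]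
  rw [← Finset.sum_add_distrib, Finset.sum_div]
  refine (norm_sum_le _ _).trans (Finset.sum_le_sum fun k _ => ?_)
  rw [ketbra_apply, norm_mul, norm_star]
  linarith [two_mul_le_add_sq ‖b k i‖ ‖b k j‖]

theorem isCompact_sameDiagonal (ρ : Matrix ι ι ℂ) : IsCompact (sameDiagonal ρ) := by
  have hc : IsCompact (Set.univ.pi fun i => Set.univ.pi fun j =>
      Metric.closedBall (0 : ℂ) (((ρ i i).re + (ρ j j).re) / 2) : Set (ι → ι → ℂ)) :=
    isCompact_univ_pi fun i => isCompact_univ_pi fun j => isCompact_closedBall _ _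
  refine IsCompact.of_isClosed_subset (X := ι → ι → ℂ) hc ?_ ?_
  · have : sameDiagonal ρ = ({σ | σ.conjTranspose = σ} ∩
        ⋂ x : ι → ℂ, {σ | 0 ≤ star x ⬝ᵥ (σ.mulVec x)}) ∩ ⋂ i, {σ | σ i i = ρ i i} := by
      ext σ
      simp [sameDiagonal, Matrix.posSemidef_iff_dotProduct_mulVec, Matrix.IsHermitian]
    rw [this]
    refine (IsClosed.inter ?_ (isClosed_iInter fun x => ?_)).inter (isClosed_iInter fun i => ?_)
    · exact isClosed_eq (X := Matrix ι ι ℂ) (by fun_prop) continuous_id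
    · exact isClosed_le (f := fun _ : Matrix ι ι ℂ => (0 : ℂ))
        (g := fun σ => star x ⬝ᵥ σ.mulVec x) continuous_const
        (continuous_const.dotProduct (continuous_id.matrix_mulVec continuous_const))
    · exact isClosed_eq (f := fun σ : Matrix ι ι ℂ => σ i i) (g := fun _ => ρ i i)
        (continuous_id.matrix_elem i i) continuous_const
  · rintro σ ⟨hσ, hd⟩ i - j -
    rw [mem_closedBall_zero_iff, ← hd, ← hd]
    exact norm_apply_le_of_posSemidef hσ i j

/-- A dimension count: two independent vectors in a decomposition of `σ` span four real dimensions
of Hermitian perturbations, while the diagonal imposes at most three real conditions. A nonzero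
perturbation of zero diagonal, taken with both signs, contradicts extremality. -/
theorem exists_eq_ketbra_of_mem_extremePoints (hι : Fintype.card ι ≤ 3) {ρ σ : Matrix ι ι ℂ}
    (hσ : σ ∈ (sameDiagonal ρ).extremePoints ℝ) : ∃ ψ, ketbra ψ = σ := by
  obtain ⟨⟨hpos, hd⟩, hext⟩ := mem_extremePoints.1 hσ
  obtain ⟨m, b, hb⟩ := exists_eq_sum_ketbra hpos
  by_cases hdep : ∃ (u : ι → ℂ) (c : Fin m → ℂ), ∀ k, b k = c k • u
  · obtain ⟨u, c, hc⟩ := hdep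
    refine ⟨((√(∑ k, ‖c k‖ ^ 2) : ℝ) : ℂ) • u, ?_⟩
    rw [ketbra_smul, Complex.norm_real, Real.norm_eq_abs, sq_abs,
      Real.sq_sqrt (Finset.sum_nonneg fun k _ => by positivity), hb, Complex.ofReal_sum,
      Finset.sum_smul]
    exact Finset.sum_congr rfl fun k _ => by rw [hc, ketbra_smul]
  · exfalso
    obtain ⟨k, l, hkl, hli⟩ : ∃ k l, k ≠ l ∧ LinearIndependent ℂ ![b k, b l] := by
      push Not at hdep
      obtain ⟨k, hk⟩ : ∃ k, b k ≠ 0 := by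
        by_contra! h
        obtain ⟨k, hk⟩ := hdep 0 0
        exact hk (by simp [h])
      obtain ⟨l, hl⟩ : ∃ l, ∀ c : ℂ, c • b k ≠ b l := by
        by_contra! h
        choose c hc using h
        obtain ⟨l, hl⟩ := hdep (b k) c
        exact hl (hc l).symm
      refine ⟨k, l, ?_, (LinearIndependent.pair_iff' hk).2 hl⟩
      rintro rfl
      exact hl 1 (one_smul _ _)
    let T : ℝ × ℝ × ℂ →ₗ[ℝ] ι → ℝ :=
      (LinearMap.pi fun i => entryRe i i) ∘ₗ hermitianSpan (b k) (b l)
    obtain ⟨x, hx, hx0⟩ : ∃ x ∈ LinearMap.ker T, x ≠ 0 := by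
      refine (Submodule.ne_bot_iff _).1 (LinearMap.ker_ne_bot_of_finrank_lt ?_)
      simp [Complex.finrank_real_complex]
      omega
    set H := hermitianSpan (b k) (b l) with hH
    have hHd : ∀ i, H x i i = 0 := by
      intro i
      have h1 : (H x i i).re = 0 := congrFun (LinearMap.mem_ker.1 hx) i
      have h2 : (H x i i).im = 0 := by
        simp [hH, hermitianSpan_apply, crossTerm, ketbra_diag, Matrix.vecMulVec_apply]
        simp only [← Complex.ofReal_pow, Complex.ofReal_im]
        ring
      exact Complex.ext h1 h2
    set ε : ℝ := (|x.1| + |x.2.1| + ‖x.2.2‖ ^ 2 + 1)⁻¹ with hε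
    have hε0 : 0 < ε := by positivity
    have hmul : ε * (|x.1| + |x.2.1| + ‖x.2.2‖ ^ 2 + 1) = 1 := inv_mul_cancel₀ (by positivity)
    have hrest : ∃ τ : Matrix ι ι ℂ, τ.PosSemidef ∧ σ = τ + (ketbra (b k) + ketbra (b l)) := by
      refine ⟨∑ j ∈ Finset.univ \ {k, l}, ketbra (b j),
        Matrix.posSemidef_sum _ fun j _ => posSemidef_ketbra _, ?_⟩
      rw [← Finset.sum_pair (f := fun j => ketbra (b j)) hkl, hb]
      exact (Finset.sum_sdiff (Finset.subset_univ _)).symm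
    obtain ⟨τ, hτ, hστ⟩ := hrest
    have hmem : ∀ y : ℝ × ℝ × ℂ, (y = x ∨ y = -x) → σ + ε • H y ∈ sameDiagonal ρ := by
      intro y hy
      refine ⟨?_, fun i => ?_⟩
      · rw [hστ, add_assoc]
        refine hτ.add (posSemidef_add_smul_hermitianSpan _ _ y hε0.le ?_)
        rcases hy with rfl | rfl
        · exact hmul.le
        · simpa using hmul.le
      · rcases hy with rfl | rfl <;> simp [hHd, hd]
    have hseg : σ ∈ openSegment ℝ (σ + ε • H x) (σ + ε • H (-x)) := by
      refine ⟨1 / 2, 1 / 2, by norm_num, by norm_num, by norm_num, ?_⟩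
      rw [map_neg, smul_neg]
      module
    have := (hext _ (hmem x (.inl rfl)) _ (hmem (-x) (.inr rfl)) hseg).1
    rw [add_eq_left, smul_eq_zero] at this
    exact hx0 (hermitianSpan_injective hli
      ((this.resolve_left hε0.ne').trans (map_zero _).symm))

/-- Krein-Milman on `sameDiagonal ρ`: the extreme points are pure states with the populations of
`ρ`. The closure is harmless because the hull of the bounded pure states is compact. -/
theorem IsDensityMatrix.isMixtureOfBounded_of_card_le_three (hι : Fintype.card ι ≤ 3)
    {ρ : Matrix ι ι ℂ} (hρ : IsDensityMatrix ρ) {c : ℝ} (hc : ∀ i, (ρ i i).re ≤ c) :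
    IsMixtureOfBounded c ρ := by
  have : LocallyConvexSpace ℝ (Matrix ι ι ℂ) :=
    inferInstanceAs (LocallyConvexSpace ℝ (ι → ι → ℂ))
  have hmem : ρ ∈ sameDiagonal ρ := ⟨hρ.posSemidef, fun _ => rfl⟩
  rw [← closure_convexHull_extremePoints (isCompact_sameDiagonal ρ) (convex_sameDiagonal ρ)] at hmem
  refine closure_minimal (convexHull_mono ?_)
    (isCompact_convexHull_of_finiteDimensional (isCompact_boundedPureStates c)).isClosed hmem
  intro σ hσ
  obtain ⟨ψ, rfl⟩ := exists_eq_ketbra_of_mem_extremePoints hι hσ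
  have hd : ∀ i, ‖ψ i‖ ^ 2 = (ρ i i).re := fun i => by
    rw [← (extremePoints_subset hσ).2 i, ketbra_diag, Complex.ofReal_re]
  refine ⟨ψ, ?_, fun i => (hd i).trans_le (hc i), rfl⟩
  have := congrArg Complex.re hρ.trace_eq_one
  rw [Matrix.trace, Complex.re_sum] at this
  simpa [IsUnitVector, hd] using this

end LowDimension

/-! ### One-shot values and asymptotic rates -/

section Rates

variable {ι : Type*} [Fintype ι] [DecidableEq ι]

theorem IsDensityMatrix.nonempty {ρ : Matrix ι ι ℂ} (hρ : IsDensityMatrix ρ) : Nonempty ι := by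
  by_contra h
  rw [not_nonempty_iff] at h
  simpa [Matrix.trace] using hρ.trace_eq_one

theorem IsDensityMatrix.apply_self_eq_norm {ρ : Matrix ι ι ℂ} (hρ : IsDensityMatrix ρ) (i : ι) :
    ρ i i = (‖ρ i i‖ : ℂ) :=
  Complex.eq_coe_norm_of_nonneg hρ.posSemidef.diag_nonneg

theorem re_apply_self_le_opNorm {ρ : Matrix ι ι ℂ} (i : ι) :
    (ρ i i).re ≤ opNorm (dephase ρ) := by
  rw [opNorm_dephase]
  exact (Complex.re_le_norm _).trans (norm_le_pi_norm (fun i => ρ i i) i)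

theorem IsDensityMatrix.exists_apply_self_eq_opNorm {ρ : Matrix ι ι ℂ} (hρ : IsDensityMatrix ρ) :
    ∃ i, ρ i i = (opNorm (dephase ρ) : ℂ) := by
  have := hρ.nonempty
  obtain ⟨i, hi⟩ := Finite.exists_max fun i => ‖ρ i i‖
  refine ⟨i, ?_⟩
  rw [hρ.apply_self_eq_norm, opNorm_dephase]
  congr 1
  exact (norm_le_pi_norm (fun i => ρ i i) i).antisymm
    ((pi_norm_le_iff_of_nonneg (norm_nonneg _)).2 hi)

theorem IsDensityMatrix.opNorm_dephase_pos {ρ : Matrix ι ι ℂ} (hρ : IsDensityMatrix ρ) :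
    0 < opNorm (dephase ρ) := by
  by_contra! h
  have h1 : ∑ i, (ρ i i).re ≤ 0 := Finset.sum_nonpos fun i _ => (re_apply_self_le_opNorm i).trans h
  have h2 := congrArg Complex.re hρ.trace_eq_one
  rw [Matrix.trace, Complex.re_sum] at h2
  simp only [Matrix.diag_apply, Complex.one_re] at h2
  linarith

theorem IsDensityMatrix.opNorm_dephase_pow_le {ρ : Matrix ι ι ℂ} (hρ : IsDensityMatrix ρ) {n : ℕ}
    {c : ℝ} (h : IsMixtureOfBounded c (tensorPow ρ n)) : opNorm (dephase ρ) ^ n ≤ c := by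
  obtain ⟨i, hi⟩ := hρ.exists_apply_self_eq_opNorm
  have := h.diag_le fun _ => i
  simpa [tensorPow, hi, ← Complex.ofReal_pow] using this

theorem IsDensityMatrix.opNorm_dephase_le {ρ : Matrix ι ι ℂ} (hρ : IsDensityMatrix ρ) {c : ℝ}
    (h : IsMixtureOfBounded c ρ) : opNorm (dephase ρ) ≤ c := by
  obtain ⟨i, hi⟩ := hρ.exists_apply_self_eq_opNorm
  have := h.diag_le i
  rwa [hi, Complex.ofReal_re] at this

theorem le_floor_of_mem_distillableDims {O : FreeClass} {σ : Matrix ι ι ℂ} {ν : ℝ} (hν : 0 < ν)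
    (hσ : ∀ c, IsMixtureOfBounded c σ → ν ≤ c) {m : ℕ} (hm : m ∈ distillableDims O 0 σ) :
    m ≤ ⌊ν⁻¹⌋₊ := by
  obtain ⟨hm1, hmix⟩ := mem_distillableDims_iff.1 hm
  have hm0 : (0 : ℝ) < m := by exact_mod_cast hm1
  refine Nat.le_floor ?_
  have := hσ _ hmix
  rwa [one_div, le_inv_comm₀ hν hm0] at this

/-- The abstract lower bound `ν` covers both `ρ` itself and its tensor powers, where it is
`‖Δ(ρ)‖ⁿ`. -/
theorem isGreatest_sSup_distillableDims (O : FreeClass) {σ : Matrix ι ι ℂ} {ν : ℝ} (hν : 0 < ν)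
    (hσ : ∀ c, IsMixtureOfBounded c σ → ν ≤ c) (h1 : IsMixtureOfBounded 1 σ) :
    IsGreatest (distillableDims O 0 σ) (sSup (distillableDims O 0 σ)) := by
  have hbdd : BddAbove (distillableDims O 0 σ) :=
    ⟨_, fun m hm => le_floor_of_mem_distillableDims hν hσ hm⟩
  have hne : (distillableDims O 0 σ).Nonempty :=
    ⟨1, mem_distillableDims_iff.2 ⟨le_rfl, by simpa using h1⟩⟩
  exact ⟨Nat.sSup_mem hne hbdd, fun m hm => le_csSup hbdd hm⟩

theorem isGreatest_floor_distillableDims (O : FreeClass) {σ : Matrix ι ι ℂ} {ν : ℝ} (hν : 0 < ν)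
    (hν1 : ν ≤ 1) (hσ : ∀ c, IsMixtureOfBounded c σ → ν ≤ c) (h : IsMixtureOfBounded ν σ) :
    IsGreatest (distillableDims O 0 σ) ⌊ν⁻¹⌋₊ := by
  refine ⟨?_, fun m hm => le_floor_of_mem_distillableDims hν hσ hm⟩
  have hfl : 1 ≤ ⌊ν⁻¹⌋₊ := Nat.le_floor (by simpa using (one_le_inv₀ hν).2 hν1)
  have hfl0 : (0 : ℝ) < ⌊ν⁻¹⌋₊ := by exact_mod_cast hfl
  refine mem_distillableDims_iff.2 ⟨hfl, h.mono ?_⟩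
  rw [one_div, le_inv_comm₀ hν hfl0]
  exact Nat.floor_le (inv_nonneg.2 hν.le)

variable (O : FreeClass) {ρ : Matrix ι ι ℂ} (hρ : IsDensityMatrix ρ)
include hρ

theorem IsDensityMatrix.isGreatest_tensorPow (n : ℕ) :
    IsGreatest (distillableDims O 0 (tensorPow ρ n)) (sSup (distillableDims O 0 (tensorPow ρ n))) :=
  isGreatest_sSup_distillableDims O (pow_pos hρ.opNorm_dephase_pos n)
    (fun _ => hρ.opNorm_dephase_pow_le) (by simpa using hρ.isMixtureOfBounded_one.tensorPow n)

theorem IsDensityMatrix.assistedDistillableCoherence_tensorPow_le (n : ℕ) :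
    assistedDistillableCoherence O 0 (tensorPow ρ n) ≤
      n * -Real.logb 2 (opNorm (dephase ρ)) := by
  have hN := hρ.opNorm_dephase_pos
  have hG := (hρ.isGreatest_tensorPow O n).1
  have h1 := (mem_distillableDims_iff.1 hG).1
  have h2 := le_floor_of_mem_distillableDims (pow_pos hN n) (fun _ => hρ.opNorm_dephase_pow_le) hG
  have h3 : ((sSup (distillableDims O 0 (tensorPow ρ n)) : ℕ) : ℝ) ≤
      (opNorm (dephase ρ) ^ n)⁻¹ :=
    (Nat.le_floor_iff (by positivity)).1 h2
  calc assistedDistillableCoherence O 0 (tensorPow ρ n)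
      ≤ Real.logb 2 (opNorm (dephase ρ) ^ n)⁻¹ :=
        Real.logb_le_logb_of_le one_lt_two (by exact_mod_cast h1) h3
    _ = _ := by rw [Real.logb_inv, Real.logb_pow]; ring

/-- Products of decompositions show that distillable dimensions multiply; the sign fits Fekete's
lemma. -/
theorem IsDensityMatrix.subadditive_neg_assistedDistillableCoherence :
    Subadditive fun n => -assistedDistillableCoherence O 0 (tensorPow ρ n) := by
  intro m n
  obtain ⟨hm1, hm⟩ := mem_distillableDims_iff.1 (hρ.isGreatest_tensorPow O m).1
  obtain ⟨hn1, hn⟩ := mem_distillableDims_iff.1 (hρ.isGreatest_tensorPow O n).1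
  unfold assistedDistillableCoherence
  set M := sSup (distillableDims O 0 (tensorPow ρ m))
  set N := sSup (distillableDims O 0 (tensorPow ρ n))
  have hM0 : (0 : ℝ) < M := by exact_mod_cast hm1
  have hN0 : (0 : ℝ) < N := by exact_mod_cast hn1
  have hmul : M * N ∈ distillableDims O 0 (tensorPow ρ (m + n)) := by
    refine mem_distillableDims_iff.2 ⟨one_le_mul hm1 hn1, ?_⟩
    have := hm.tensorPow_add hn
    rwa [div_mul_div_comm, one_mul, ← Nat.cast_mul] at this
  have hle := (hρ.isGreatest_tensorPow O (m + n)).2 hmul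
  have : Real.logb 2 M + Real.logb 2 N ≤
      Real.logb 2 (sSup (distillableDims O 0 (tensorPow ρ (m + n))) : ℕ) := by
    rw [← Real.logb_mul hM0.ne' hN0.ne']
    exact Real.logb_le_logb_of_le one_lt_two (by positivity) (by exact_mod_cast hle)
  linarith

theorem IsDensityMatrix.rate_le (n : ℕ) :
    1 / (n : ℝ) * assistedDistillableCoherence O 0 (tensorPow ρ n) ≤
      -Real.logb 2 (opNorm (dephase ρ)) := by
  -- At `n = 0` the rate is `0` by the convention `1 / 0 = 0`, and the bound is nonnegative.
  rcases n.eq_zero_or_pos with rfl | hn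
  · simpa using Real.logb_nonpos one_lt_two hρ.opNorm_dephase_pos.le
      (hρ.opNorm_dephase_le hρ.isMixtureOfBounded_one)
  · have hn0 : (0 : ℝ) < n := by exact_mod_cast hn
    rw [one_div, inv_mul_le_iff₀ hn0]
    exact hρ.assistedDistillableCoherence_tensorPow_le O n

theorem IsDensityMatrix.exists_tendsto_rate :
    ∃ L : ℝ, Tendsto (fun n : ℕ => 1 / (n : ℝ) * assistedDistillableCoherence O 0 (tensorPow ρ n))
      atTop (𝓝 L) ∧ L ≤ -Real.logb 2 (opNorm (dephase ρ)) := by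
  have hsub := hρ.subadditive_neg_assistedDistillableCoherence O
  have hbdd : BddBelow (Set.range fun n : ℕ =>
      -assistedDistillableCoherence O 0 (tensorPow ρ n) / n) := by
    refine ⟨Real.logb 2 (opNorm (dephase ρ)), ?_⟩
    rintro _ ⟨n, rfl⟩
    have := hρ.rate_le O n
    rw [one_div_mul_eq_div] at this
    simp only [neg_div]
    linarith
  have hlim : Tendsto (fun n : ℕ => 1 / (n : ℝ) * assistedDistillableCoherence O 0 (tensorPow ρ n))
      atTop (𝓝 (-hsub.lim)) := by
    refine (hsub.tendsto_lim hbdd).neg.congr fun n => ?_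
    ring
  exact ⟨_, hlim, le_of_tendsto' hlim (hρ.rate_le O)⟩

theorem IsDensityMatrix.tendsto_rate
    (h : IsMixtureOfBounded (opNorm (dephase ρ)) ρ) :
    Tendsto (fun n : ℕ => 1 / (n : ℝ) * assistedDistillableCoherence O 0 (tensorPow ρ n))
      atTop (𝓝 (-Real.logb 2 (opNorm (dephase ρ)))) := by
  have hN := hρ.opNorm_dephase_pos
  have hN1 := hρ.opNorm_dephase_le hρ.isMixtureOfBounded_one
  have hlow : Tendsto (fun n : ℕ => -Real.logb 2 (opNorm (dephase ρ)) - 1 / (n : ℝ)) atTop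
      (𝓝 (-Real.logb 2 (opNorm (dephase ρ)))) := by
    simpa using tendsto_const_nhds.sub (tendsto_one_div_atTop_nhds_zero_nat (𝕜 := ℝ))
  refine tendsto_of_tendsto_of_tendsto_of_le_of_le' hlow tendsto_const_nhds ?_
    (.of_forall (hρ.rate_le O))
  filter_upwards [eventually_gt_atTop 0] with n hn
  have hn0 : (0 : ℝ) < n := by exact_mod_cast hn
  have hν := pow_pos hN n
  have hν1 := pow_le_one₀ (n := n) hN.le hN1
  have hG := isGreatest_floor_distillableDims O hν hν1 (fun _ => hρ.opNorm_dephase_pow_le)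
    (h.tensorPow n)
  have hfl1 : (1 : ℝ) ≤ ⌊(opNorm (dephase ρ) ^ n)⁻¹⌋₊ := by
    exact_mod_cast (mem_distillableDims_iff.1 hG.1).1
  -- As the floor is at least one, rounding loses at most a factor two, i.e. one bit, hence `1 / n`
  -- in the rate.
  have hle : (opNorm (dephase ρ) ^ n)⁻¹ / 2 ≤ (⌊(opNorm (dephase ρ) ^ n)⁻¹⌋₊ : ℝ) := by
    have := (Nat.lt_floor_add_one (opNorm (dephase ρ) ^ n)⁻¹).le
    linarith
  have hlog := Real.logb_le_logb_of_le one_lt_two (by positivity) hle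
  rw [Real.logb_div (by positivity) two_ne_zero, Real.logb_self_eq_one one_lt_two,
    Real.logb_inv, Real.logb_pow] at hlog
  rw [assistedDistillableCoherence, hG.csSup_eq, one_div, le_inv_mul_iff₀ hn0, mul_sub,
    mul_inv_cancel₀ hn0.ne']
  linarith

end Rates

end AssistedCoherence

theorem mainTheorem7 {ι : Type*} [Fintype ι] [DecidableEq ι] (O : FreeClass)
    (ρ : Matrix ι ι ℂ) (hρ : IsDensityMatrix ρ) :
    -- any dimension: the largest distillable dimension exists, and the upper bounds hold
    ((∃ M, IsGreatest (distillableDims O 0 ρ) M) ∧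
      assistedDistillableCoherence O 0 ρ ≤ Real.logb 2 ⌊(opNorm (dephase ρ))⁻¹⌋₊ ∧
      ∃ L : ℝ, Tendsto (fun n : ℕ => 1 / (n : ℝ) * assistedDistillableCoherence O 0 (tensorPow ρ n))
          atTop (𝓝 L) ∧
        L ≤ -Real.logb 2 (opNorm (dephase ρ))) ∧
    -- dimension at most three, or a pure state in any dimension: equality, with fidelity exactly
    -- one reached by some protocol
    ((Fintype.card ι ≤ 3 ∨ ∃ ψ : ι → ℂ, IsUnitVector ψ ∧ ρ = ketbra ψ) →
      IsGreatest (distillableDims O 0 ρ) ⌊(opNorm (dephase ρ))⁻¹⌋₊ ∧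
      1 ∈ achievableFidelities O ρ ⌊(opNorm (dephase ρ))⁻¹⌋₊ ∧
      assistedDistillableCoherence O 0 ρ = Real.logb 2 ⌊(opNorm (dephase ρ))⁻¹⌋₊ ∧
      Tendsto (fun n : ℕ => 1 / (n : ℝ) * assistedDistillableCoherence O 0 (tensorPow ρ n))
        atTop (𝓝 (-Real.logb 2 (opNorm (dephase ρ))))) := by
  have hN := hρ.opNorm_dephase_pos
  have hN1 := hρ.opNorm_dephase_le hρ.isMixtureOfBounded_one
  have hlow : ∀ c, IsMixtureOfBounded c ρ → opNorm (dephase ρ) ≤ c :=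
    fun _ => hρ.opNorm_dephase_le
  refine ⟨?_, fun hcase => ?_⟩
  · have hG := isGreatest_sSup_distillableDims O hN hlow hρ.isMixtureOfBounded_one
    refine ⟨⟨_, hG⟩, ?_, hρ.exists_tendsto_rate O⟩
    refine Real.logb_le_logb_of_le one_lt_two ?_ ?_
    · exact_mod_cast (mem_distillableDims_iff.1 hG.1).1
    · exact_mod_cast le_floor_of_mem_distillableDims hN hlow hG.1
  -- The only place where the dimension or purity is used; a pure state is its own decomposition.
  · have hmix : IsMixtureOfBounded (opNorm (dephase ρ)) ρ := by
      rcases hcase with hι | ⟨ψ, hψ, rfl⟩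
      · exact hρ.isMixtureOfBounded_of_card_le_three hι fun i => re_apply_self_le_opNorm i
      · refine subset_convexHull ℝ _ ⟨ψ, hψ, fun i => ?_, rfl⟩
        have := re_apply_self_le_opNorm (ρ := ketbra ψ) i
        rwa [ketbra_diag, Complex.ofReal_re] at this
    have hG := isGreatest_floor_distillableDims O hN hN1 hlow hmix
    obtain ⟨h1, hm⟩ := mem_distillableDims_iff.1 hG.1
    refine ⟨hG, hm.one_mem_achievableFidelities O h1, ?_, hρ.tendsto_rate O hmix⟩
    rw [assistedDistillableCoherence, hG.csSup_eq]
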